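/- Let $\alpha,\beta>-1$ and, for real $\gamma,\delta>-1$, let $w^{\gamma,\delta}(t)=(1-t)^{\gamma}(1+t)^{\delta}$ on $[-1,1]$. For $n\ge 1$ consider the $(n+2)$-point Gauss–Lobatto rule for the weight $w^{\alpha,\beta}$: its nodes are $-1=t_0<t_1<\dots<t_n<t_{n+1}=1$, where $t_1<\dots<t_n$ are the zeros of the Jacobi polynomial of degree $n$ that is orthonormal with respect to $w^{\alpha+1,\beta+1}$, and its weights are $$w_k=\int_{-1}^{1} l_k(t)\,w^{\alpha,\beta}(t)\,dt,\qquad k=0,1,\dots,n+1,$$ where $l_k$ is the Lagrange fundamental polynomial of the node $t_k$ for the nodes $t_0,\dots,t_{n+1}$. Put $\Delta t_k=t_{k+1}-t_k$ for $k=0,\dots,n$. Then there is a constant $\mathcal C>0$, depending only on $\alpha$ and $\beta$ (in particular independent of $n$ and $k$), such that for every $n\ge 1$: $$w_0\le \mathcal C\,\Delta t_0\,w^{\alpha,\beta}(t_1),\qquad w_{n+1}\le \mathcal C\,\Delta t_n\,w^{\alpha,\beta}(t_n),$$ $$\frac1{\mathcal C}\le\frac{w_k}{\Delta t_k\,w^{\alpha,\beta}(t_k)}\le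 \mathcal C\quad (k=1,\dots,n-1),\qquad \frac1{\mathcal C}\le\frac{w_n}{\Delta t_{n-1}\,w^{\alpha,\beta}(t_n)}\le \mathcal C .$$ -/

import Mathlib

open Polynomial

noncomputable section

/-- The Jacobi weight `w^{γ,δ}(t) = (1 - t)^γ (1 + t)^δ`. -/
def jacobiWeight (γ δ t : ℝ) : ℝ := (1 - t) ^ γ * (1 + t) ^ δ

/-- The inner product `∫_{-1}^1 p q w^{γ,δ}` of two polynomials. -/
def jacobiInner (γ δ : ℝ) (p q : ℝ[X]) : ℝ :=
  ∫ t in (-1 : ℝ)..1, p.eval t * q.eval t * jacobiWeight γ δ t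

/-- The monic orthogonal polynomials for the weight `w^{γ,δ}`: Gram-Schmidt orthogonalization of
the monomials `1, X, X ^ 2, …` for the inner product `jacobiInner γ δ`. -/
def jacobiMonic (γ δ : ℝ) (n : ℕ) : ℝ[X] :=
  X ^ n - ∑ k : Fin n,
    C (jacobiInner γ δ (X ^ n) (jacobiMonic γ δ k.1) /
      jacobiInner γ δ (jacobiMonic γ δ k.1) (jacobiMonic γ δ k.1)) * jacobiMonic γ δ k.1
termination_by n
decreasing_by exact k.2

/-- The Jacobi polynomial `p_n^{γ,δ}` of degree `n`, orthonormal for the weight `w^{γ,δ}`, with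
positive leading coefficient. -/
def jacobiPoly (γ δ : ℝ) (n : ℕ) : ℝ[X] :=
  C (1 / √(jacobiInner γ δ (jacobiMonic γ δ n) (jacobiMonic γ δ n))) * jacobiMonic γ δ n

/-- The zeros of `p_n^{γ,δ}`, listed in increasing order. -/
def jacobiZeros (γ δ : ℝ) (n : ℕ) : List ℝ :=
  (jacobiPoly γ δ n).roots.toFinset.sort (· ≤ ·)

/-- The nodes `t_0 = -1 < t_1 < ⋯ < t_n < t_{n+1} = 1` of the `(n+2)`-point Gauss-Lobatto rule
for the weight `w^{α,β}`: the interior node `t_k`, `1 ≤ k ≤ n`, is the `k`-th smallest zero of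
`p_n^{α+1,β+1}`. (The values at `k > n + 1` are irrelevant.) -/
def lobattoNode (α β : ℝ) (n k : ℕ) : ℝ :=
  if k = 0 then -1
  else if k ≤ n then (jacobiZeros (α + 1) (β + 1) n).getD (k - 1) 0
  else 1

/-- The gaps `Δt_k = t_{k+1} - t_k`, `k = 0, …, n`. -/
def lobattoGap (α β : ℝ) (n k : ℕ) : ℝ :=
  lobattoNode α β n (k + 1) - lobattoNode α β n k

/-- The weights `w_k = ∫_{-1}^1 l_k w^{α,β}`, `k = 0, …, n + 1`, of the Gauss-Lobatto rule, where
`l_k` is the Lagrange fundamental polynomial of `t_k` for the nodes `t_0, …, t_{n+1}`. -/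
def lobattoWeight (α β : ℝ) (n k : ℕ) : ℝ :=
  ∫ t in (-1 : ℝ)..1,
    (Lagrange.basis (Finset.range (n + 2)) (lobattoNode α β n) k).eval t * jacobiWeight α β t

end

/-!
The interior nodes are the zeros of the monic orthogonal polynomial `y` for `w^{a,b}`, where
`a = α + 1` and `b = β + 1` are positive. It solves the Jacobi equation
`(1 - t²) y'' + (b - a - (a + b + 2) t) y' + l y = 0` with `l = n (n + a + b + 1)`. All estimates
compare `y` on neighbouring gaps only; neither the asymptotic behaviour nor the normalization of
the Jacobi polynomials enters.

*Gaps.* On a zero-free interval the angle `arctan (√(1 - t²) y' / (√l y))` decreases at rate at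
least `√l / (2 √(1 - t²))` as long as `1 - t²` is not too small, which bounds the length of a gap from above
(`SolvesJacobi.sub_le_of_ne_zero`, `JacobiSolution.sub_le`). The energy
`E = (1 - t²) y'² + l y²` satisfies `|E'| ≤ 2κ E / (1 - t²)`, so by Gronwall it is comparable at
points `x`, `z` for which `1 + x`, `1 + z` and `1 - x`, `1 - z` are comparable
(`JacobiSolution.energy_comparable`), in particular on a whole gap between two zeros. At a critical
point inside the gap this bounds its length from below. At the end points `±1` the equation itself
gives `y'(-1)` in terms of `y(-1)`. Altogether each gap next to a zero `r` has length of order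
`√((1 - r²) / l)` (`JacobiSolution.exists_gap_comparable`), and `|y'|` is at most a multiple of
`|y'(r)|` on it (`JacobiSolution.exists_sq_derivative_le`).

*Weights.* The rule is exact up to degree `2n + 1`, so that `w_k F(t_k) = ∫ F w^{α,β}` when `F`
vanishes at the other nodes (`jacobiFunctional_eq_mul_lobattoWeight`). For an interior node `r` and
`F = (1 - X²) (y / (X - r))²` the integral is at least its part near `r`, which gives the lower
bound (`sub_mul_jacobiWeight_le`). For the upper bound `F` is divided by the linear factors of the
two adjacent nodes: it becomes nonpositive outside the two gaps at `r`, and inside it is at most a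
multiple of its value at `r` (`lobattoWeight_le_of_sq_eval_le`). For the end points
`F = (X ± 1) y² / (X - z)`, with `z` the nearest zero, plays the same role (`lobattoWeight_end_le`).
-/

/-! ### The Jacobi differential equation: energy and Riccati estimates -/

/-- The polynomial `y` solves the Jacobi differential equation with parameters `a`, `b` and
eigenvalue `l`. -/
noncomputable def SolvesJacobi (a b l : ℝ) (y : ℝ[X]) : Prop :=
  ∀ t : ℝ, (1 - t ^ 2) * (derivative (derivative y)).eval t +
    (b - a - (a + b + 2) * t) * (derivative y).eval t + l * y.eval t = 0

theorem SolvesJacobi.reflect {a b l : ℝ} {y : ℝ[X]} (h : SolvesJacobi a b l y) :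
    SolvesJacobi b a l (y.comp (-X)) := by
  intro t
  have := h (-t)
  simp [derivative_comp] at this ⊢
  linarith

/-- The energy `(1 - t²) y'² + l y²` of a solution of the Jacobi equation. -/
noncomputable def jacobiEnergy (l : ℝ) (y : ℝ[X]) (t : ℝ) : ℝ :=
  (1 - t ^ 2) * (derivative y).eval t ^ 2 + l * y.eval t ^ 2

theorem jacobiEnergy_reflect (l : ℝ) (y : ℝ[X]) (t : ℝ) :
    jacobiEnergy l (y.comp (-X)) t = jacobiEnergy l y (-t) := by
  simp [jacobiEnergy, derivative_comp]

theorem hasDerivAt_one_sub_sq (t : ℝ) : HasDerivAt (fun t : ℝ => 1 - t ^ 2) (-(2 * t)) t := by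
  simpa using (hasDerivAt_pow 2 t).const_sub 1

theorem SolvesJacobi.hasDerivAt_energy {a b l : ℝ} {y : ℝ[X]} (h : SolvesJacobi a b l y) (t : ℝ) :
    HasDerivAt (jacobiEnergy l y)
      (-2 * (b - a - (a + b + 1) * t) * (derivative y).eval t ^ 2) t := by
  have h1 := ((hasDerivAt_one_sub_sq t).mul (((derivative y).hasDerivAt t).pow 2)).add
    (((y.hasDerivAt t).pow 2).const_mul l)
  refine h1.congr_deriv ?_
  have := h t
  simp
  linear_combination (2 * (derivative y).eval t) * this

theorem abs_drift_le {a b t : ℝ} (ha : 0 < a) (hb : 0 < b) (h1 : -1 ≤ t) (h2 : t ≤ 1) :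
    |b - a - (a + b + 1) * t| ≤ 2 * a + 2 * b + 1 := by
  rw [abs_le]
  constructor <;> nlinarith

/-- Gronwall's inequality for the energy: since `|E'| ≤ 2κ E / (1 - t²)`, the energy times
`((1 + t) / (1 - t)) ^ κ` is nondecreasing. -/
theorem SolvesJacobi.energy_le {a b l : ℝ} {y : ℝ[X]} (h : SolvesJacobi a b l y)
    (ha : 0 < a) (hb : 0 < b) (hl : 0 < l) {κ : ℕ} (hκ : 2 * a + 2 * b + 1 ≤ κ) {x z : ℝ}
    (hx : -1 < x) (hxz : x ≤ z) (hz : z < 1) :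
    jacobiEnergy l y x ≤ jacobiEnergy l y z * ((1 + z) * (1 - x) / ((1 + x) * (1 - z))) ^ κ := by
  have hder : ∀ t ∈ Set.Ioo (-1 : ℝ) 1, HasDerivAt
      (fun t => jacobiEnergy l y t * ((1 + t) / (1 - t)) ^ κ)
      ((-2 * (b - a - (a + b + 1) * t) * (derivative y).eval t ^ 2) * ((1 + t) / (1 - t)) ^ κ +
        jacobiEnergy l y t * (κ * ((1 + t) / (1 - t)) ^ (κ - 1) * (2 / (1 - t) ^ 2))) t := by
    intro t ht
    have h0 : (1 - t) ≠ 0 := by linarith [ht.2]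
    have hs : HasDerivAt (fun t : ℝ => (1 + t) / (1 - t)) (2 / (1 - t) ^ 2) t := by
      have := ((hasDerivAt_id t).const_add 1).div ((hasDerivAt_id t).const_sub 1) h0
      refine this.congr_deriv ?_
      simp only [id]
      ring
    exact (h.hasDerivAt_energy t).mul (hs.pow κ)
  have hmono : MonotoneOn (fun t => jacobiEnergy l y t * ((1 + t) / (1 - t)) ^ κ)
      (Set.Ioo (-1 : ℝ) 1) := by
    apply monotoneOn_of_deriv_nonneg (convex_Ioo _ _)
    · exact fun t ht => (hder t ht).continuousAt.continuousWithinAt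
    · rw [interior_Ioo]
      exact fun t ht => (hder t ht).differentiableAt.differentiableWithinAt
    · rw [interior_Ioo]
      intro t ht
      rw [(hder t ht).deriv]
      have h1 : 0 < 1 + t := by linarith [ht.1]
      have h2 : 0 < 1 - t := by linarith [ht.2]
      have hκ0 : κ ≠ 0 := by
        rintro rfl
        norm_num at hκ
        linarith
      have hd := (abs_le.1 (abs_drift_le ha hb ht.1.le ht.2.le)).2
      obtain ⟨m, rfl⟩ := Nat.exists_eq_succ_of_ne_zero hκ0
      set σ := (1 + t) / (1 - t) with hσ
      have hσ0 : 0 < σ := by positivity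
      have e1 : σ * (1 - t) = 1 + t := by rw [hσ]; field_simp
      set v := (derivative y).eval t
      have hE : (1 - t ^ 2) * v ^ 2 ≤ jacobiEnergy l y t := by
        have : 0 ≤ l * y.eval t ^ 2 := by positivity
        simp only [jacobiEnergy]
        linarith
      have e2 : (1 - t ^ 2) / (1 - t) ^ 2 = σ := by
        rw [hσ]; field_simp; ring
      have e3 : σ * v ^ 2 ≤ jacobiEnergy l y t / (1 - t) ^ 2 := by
        rw [← e2, div_mul_eq_mul_div]
        gcongr
      have hcast : (0 : ℝ) ≤ (m.succ : ℝ) := by positivity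
      have key : 0 ≤ -2 * (b - a - (a + b + 1) * t) * v ^ 2 * σ +
          m.succ * 2 * (jacobiEnergy l y t / (1 - t) ^ 2) := by
        have h5 : (m.succ : ℝ) * (σ * v ^ 2) ≤
          m.succ * (jacobiEnergy l y t / (1 - t) ^ 2) := by gcongr
        have h6 : (b - a - (a + b + 1) * t) * (σ * v ^ 2) ≤ m.succ * (σ * v ^ 2) := by
          have : 0 ≤ σ * v ^ 2 := by positivity
          apply mul_le_mul_of_nonneg_right _ this
          linarith
        linarith
      have : 0 ≤ σ ^ m * (-2 * (b - a - (a + b + 1) * t) * v ^ 2 * σ +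
          m.succ * 2 * (jacobiEnergy l y t / (1 - t) ^ 2)) := by positivity
      convert this using 1
      simp only [Nat.succ_sub_one, pow_succ]
      ring
  have h1 : 0 < 1 + x := by linarith
  have h2 : 0 < 1 - z := by linarith
  have h3 : 0 < 1 - x := by linarith
  have h4 : 0 < 1 + z := by linarith
  have := hmono ⟨hx, by linarith⟩ ⟨by linarith, hz⟩ hxz
  simp only at this
  have e : (1 + z) * (1 - x) / ((1 + x) * (1 - z)) =
    ((1 + z) / (1 - z)) / ((1 + x) / (1 - x)) := by field_simp
  rw [e, div_pow, ← mul_div_assoc, le_div_iff₀ (by positivity)]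
  exact this

/-- The reverse Gronwall inequality, obtained by reflection. -/
theorem SolvesJacobi.energy_le' {a b l : ℝ} {y : ℝ[X]} (h : SolvesJacobi a b l y)
    (ha : 0 < a) (hb : 0 < b) (hl : 0 < l) {κ : ℕ} (hκ : 2 * a + 2 * b + 1 ≤ κ) {x z : ℝ}
    (hx : -1 < x) (hxz : x ≤ z) (hz : z < 1) :
    jacobiEnergy l y z ≤ jacobiEnergy l y x * ((1 + z) * (1 - x) / ((1 + x) * (1 - z))) ^ κ := by
  have := h.reflect.energy_le hb ha hl (κ := κ) (by linarith) (x := -z) (z := -x)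
    (by linarith) (by linarith) (by linarith)
  rw [jacobiEnergy_reflect, jacobiEnergy_reflect, neg_neg, neg_neg] at this
  convert this using 3
  ring

/-- Riccati comparison: on an interval without zeros, where `1 - t²` is not too small, the angle
`arctan (√(1 - t²) y' / (√l y))` decreases at rate at least `√l / (2 √(1 - t²))`. As the angle
stays in an interval of length `π`, the interval is short. -/
theorem SolvesJacobi.sub_le_of_ne_zero {a b l : ℝ} {y : ℝ[X]} (h : SolvesJacobi a b l y)
    (ha : 0 < a) (hb : 0 < b) (hl : 0 < l) {x z : ℝ}
    (hx : -1 < x) (hxz : x ≤ z) (hz : z < 1) (hy : ∀ t ∈ Set.Icc x z, y.eval t ≠ 0)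
    (hd : ∀ t ∈ Set.Icc x z, (2 * a + 2 * b + 1) ^ 2 ≤ l * (1 - t ^ 2)) :
    √l * (z - x) ≤ 2 * Real.pi * √((1 + z) * (1 - x)) := by
  set M := √((1 + z) * (1 - x)) with hM
  have hM0 : 0 < M := Real.sqrt_pos.2 (mul_pos (by linarith) (by linarith))
  set q := √l with hq
  have hq0 : 0 < q := Real.sqrt_pos.2 hl
  have hq2 : q ^ 2 = l := Real.sq_sqrt hl.le
  set s : ℝ → ℝ := fun t => √(1 - t ^ 2) * (derivative y).eval t / (q * y.eval t) with hs
  have hanti : AntitoneOn (fun t => Real.arctan (s t) + q / (2 * M) * t) (Set.Icc x z) := by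
    have hder : ∀ t ∈ Set.Icc x z, ∃ f' ≤ 0,
        HasDerivAt (fun t => Real.arctan (s t) + q / (2 * M) * t) f' t := by
      intro t ht
      have hyt := hy t ht
      have ht1 : 0 < 1 + t := by linarith [ht.1]
      have ht2 : 0 < 1 - t := by linarith [ht.2]
      have hpos : 0 < 1 - t ^ 2 := by nlinarith
      set d := √(1 - t ^ 2) with hdd
      have hd0 : 0 < d := Real.sqrt_pos.2 hpos
      have hd2 : d ^ 2 = 1 - t ^ 2 := Real.sq_sqrt hpos.le
      have hdM : d ≤ M := by
        apply Real.sqrt_le_sqrt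
        have : (1 + t) * (1 - t) ≤ (1 + z) * (1 - x) := by
          apply mul_le_mul <;> linarith [ht.1, ht.2]
        linarith
      have hsq : HasDerivAt (fun t : ℝ => √(1 - t ^ 2)) (-t / d) t := by
        refine ((hasDerivAt_one_sub_sq t).sqrt hpos.ne').congr_deriv ?_
        rw [← hdd]
        field_simp
      have hds := (hsq.mul ((derivative y).hasDerivAt t)).div ((y.hasDerivAt t).const_mul q)
        (mul_ne_zero hq0.ne' hyt)
      have hdf := hds.arctan.add ((hasDerivAt_id t).const_mul (q / (2 * M)))
      refine ⟨_, ?_, hdf⟩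
      have hode := h t
      simp only [Pi.mul_apply, Pi.div_apply, mul_one]
      rw [← hdd]
      set v := (derivative y).eval t
      set u := y.eval t
      set w := (derivative (derivative y)).eval t
      -- the Riccati variable `r = y' / y`
      obtain ⟨r, hr⟩ : ∃ r, r = v / u := ⟨_, rfl⟩
      have hv : v = r * u := by rw [hr]; field_simp
      have hw : d ^ 2 * w = -(b - a - (a + b + 2) * t) * (r * u) - q ^ 2 * u := by
        rw [hd2, hq2, ← hv]; linarith
      have e1 : d * v / (q * u) = d * r / q := by rw [hv]; field_simp
      have e2 : ((-t / d * v + d * w) * (q * u) - d * v * (q * v)) / (q * u) ^ 2 =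
          (-(b - a - (a + b + 1) * t) * r - q ^ 2 - d ^ 2 * r ^ 2) / (q * d) := by
        have : w = (-(b - a - (a + b + 2) * t) * (r * u) - q ^ 2 * u) / d ^ 2 := by
          rw [← hw]; field_simp
        rw [this, hv]
        field_simp
        ring
      rw [e1, e2]
      have hB := abs_drift_le (t := t) ha hb (by linarith) (by linarith)
      have hK : 2 * a + 2 * b + 1 ≤ q * d := by
        have := hd t ht
        rw [← hq2, ← hd2, ← mul_pow] at this
        exact le_of_sq_le_sq this (by positivity)
      have h1 : -(b - a - (a + b + 1) * t) * r ≤ (q ^ 2 + d ^ 2 * r ^ 2) / 2 := by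
        calc -(b - a - (a + b + 1) * t) * r ≤ |b - a - (a + b + 1) * t| * |r| := by
              rw [← abs_mul]
              have := neg_abs_le ((b - a - (a + b + 1) * t) * r)
              linarith
          _ ≤ (q * d) * |r| := by
              gcongr
              exact hB.trans hK
          _ ≤ (q ^ 2 + d ^ 2 * r ^ 2) / 2 := by
              rw [← sq_abs r]
              nlinarith [sq_nonneg (q - d * |r|)]
      have h2 : (-(b - a - (a + b + 1) * t) * r - q ^ 2 - d ^ 2 * r ^ 2) / (q * d) ≤
          -((q / (2 * d)) * (1 + (d * r / q) ^ 2)) := by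
        rw [div_le_iff₀ (by positivity)]
        have : -((q / (2 * d)) * (1 + (d * r / q) ^ 2)) * (q * d) =
          -(q ^ 2 + d ^ 2 * r ^ 2) / 2 := by
          field_simp
        rw [this]
        linarith
      have h3 : 1 / (1 + (d * r / q) ^ 2) *
          ((-(b - a - (a + b + 1) * t) * r - q ^ 2 - d ^ 2 * r ^ 2) / (q * d)) ≤
          -(q / (2 * d)) := by
        rw [one_div, inv_mul_le_iff₀ (by positivity)]
        linarith
      have h4 : q / (2 * M) ≤ q / (2 * d) := by gcongr
      linarith
    apply antitoneOn_of_deriv_nonpos (convex_Icc _ _)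
    · intro t ht
      obtain ⟨f', -, hf⟩ := hder t ht
      exact hf.continuousAt.continuousWithinAt
    · intro t ht
      obtain ⟨f', -, hf⟩ := hder t (interior_subset ht)
      exact hf.differentiableAt.differentiableWithinAt
    · intro t ht
      obtain ⟨f', h0, hf⟩ := hder t (interior_subset ht)
      rwa [hf.deriv]
  have h1 := hanti (Set.left_mem_Icc.2 hxz) (Set.right_mem_Icc.2 hxz) hxz
  simp only at h1
  have h2 := Real.neg_pi_div_two_lt_arctan (s z)
  have h3 := Real.arctan_lt_pi_div_two (s x)
  have h4 : q / (2 * M) * (z - x) ≤ Real.pi := by linarith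
  have h5 : q / (2 * M) * (z - x) = q * (z - x) / (2 * M) := by ring
  rw [h5, div_le_iff₀ (by positivity)] at h4
  linarith

/-! ### Gaps between zeros -/

/-- A Jacobi polynomial as seen by the differential equation: `y` solves the Jacobi equation with
positive parameters, all its roots are simple and lie in `(-1, 1)`. The integer `κ` bounds the
parameters; all constants below depend on `κ` only, so that they are unchanged by the reflection
`t ↦ -t`, which exchanges `a` and `b`. -/
structure JacobiSolution (κ : ℕ) (a b l : ℝ) (y : ℝ[X]) : Prop where
  pos_left : 0 < a
  pos_right : 0 < b
  le_kappa : 2 * a + 2 * b + 1 ≤ κ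
  two_le : 2 ≤ l
  ode : SolvesJacobi a b l y
  exists_prod : ∃ (S : Finset ℝ) (c : ℝ), c ≠ 0 ∧ y = C c * ∏ r ∈ S, (X - C r) ∧
    ∀ r ∈ S, -1 < r ∧ r < 1

/-- The open interval `(x, z)` in `[-1, 1]` contains no root of `y`, and its end points are roots
of `y` or end points of `[-1, 1]`. -/
structure IsGap (y : ℝ[X]) (x z : ℝ) : Prop where
  neg_one_le : -1 ≤ x
  lt : x < z
  le_one : z ≤ 1
  ne_zero : ∀ t ∈ Set.Ioo x z, y.eval t ≠ 0
  left : x = -1 ∨ y.eval x = 0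
  right : z = 1 ∨ y.eval z = 0

theorem IsGap.reflect {y : ℝ[X]} {x z : ℝ} (h : IsGap y x z) :
    IsGap (y.comp (-X)) (-z) (-x) where
  neg_one_le := by linarith [h.le_one]
  lt := by linarith [h.lt]
  le_one := by linarith [h.neg_one_le]
  ne_zero t ht := by
    simpa using h.ne_zero (-t) ⟨by linarith [ht.2], by linarith [ht.1]⟩
  left := by simpa using h.right
  right := by simpa [neg_eq_iff_eq_neg] using h.left

theorem abs_eval_sub_le {y : ℝ[X]} {p q M : ℝ} (hpq : p ≤ q)
    (hM : ∀ t ∈ Set.Icc p q, |(derivative y).eval t| ≤ M) :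
    |y.eval q - y.eval p| ≤ M * (q - p) := by
  have := (convex_Icc p q).norm_image_sub_le_of_norm_hasDerivWithin_le (f := fun t => y.eval t)
    (f' := fun t => (derivative y).eval t) (C := M)
    (fun t _ => (y.hasDerivAt t).hasDerivWithinAt) hM (Set.left_mem_Icc.2 hpq)
    (Set.right_mem_Icc.2 hpq)
  rwa [Real.norm_eq_abs, Real.norm_eq_abs, abs_of_nonneg (by linarith : 0 ≤ q - p)] at this

namespace JacobiSolution

variable {κ : ℕ} {a b l : ℝ} {y : ℝ[X]}

theorem reflect (h : JacobiSolution κ a b l y) : JacobiSolution κ b a l (y.comp (-X)) where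
  pos_left := h.pos_right
  pos_right := h.pos_left
  le_kappa := by linarith [h.le_kappa]
  two_le := h.two_le
  ode := h.ode.reflect
  exists_prod := by
    obtain ⟨S, c, hc, hy, hS⟩ := h.exists_prod
    refine ⟨S.image Neg.neg, c * (-1) ^ S.card, by simp [hc], ?_, ?_⟩
    · rw [hy, Finset.prod_image (by simp), ← Finset.prod_const, C_mul, mul_assoc,
        map_prod, ← Finset.prod_mul_distrib]
      simp only [mul_comp, C_comp, Polynomial.prod_comp]
      congr 1
      refine Finset.prod_congr rfl fun r _ => ?_
      simp
      ring
    · intro r hr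
      obtain ⟨s, hs, rfl⟩ := Finset.mem_image.1 hr
      constructor <;> linarith [(hS s hs).1, (hS s hs).2]

theorem one_le_kappa (h : JacobiSolution κ a b l y) : (1 : ℝ) ≤ κ := by
  linarith [h.le_kappa, h.pos_left, h.pos_right]

theorem mem_Ioo_of_root (h : JacobiSolution κ a b l y) {r : ℝ} (hr : y.eval r = 0) :
    r ∈ Set.Ioo (-1 : ℝ) 1 := by
  obtain ⟨S, c, hc, rfl, hS⟩ := h.exists_prod
  simp only [eval_mul, eval_C, eval_prod, eval_sub, eval_X, mul_eq_zero, hc, false_or,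
    Finset.prod_eq_zero_iff, sub_eq_zero] at hr
  obtain ⟨s, hs, rfl⟩ := hr
  exact hS r hs

theorem exists_ne_zero (h : JacobiSolution κ a b l y) :
    ∃ t ∈ Set.Ioo (-1 : ℝ) 1, y.eval t ≠ 0 := by
  obtain ⟨S, c, hc, rfl, hS⟩ := h.exists_prod
  obtain ⟨t, ht, hn⟩ := (Set.Ioo_infinite (show (-1 : ℝ) < 1 by norm_num)).exists_notMem_finset S
  refine ⟨t, ht, ?_⟩
  simp only [eval_mul, eval_C, eval_prod, eval_sub, eval_X, ne_eq, mul_eq_zero, hc, false_or,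
    Finset.prod_eq_zero_iff, sub_eq_zero, not_exists, not_and]
  rintro s hs rfl
  exact hn hs

/-- To the left of all the roots, `|y'|` decreases. -/
theorem abs_derivative_le (h : JacobiSolution κ a b l y) {s t : ℝ} (hst : s ≤ t)
    (ht : ∀ r, y.eval r = 0 → t ≤ r) :
    |(derivative y).eval t| ≤ |(derivative y).eval s| := by
  obtain ⟨S, c, hc, rfl, -⟩ := h.exists_prod
  have hS : ∀ r ∈ S, t ≤ r := by
    intro r hr
    apply ht
    simp [eval_prod, Finset.prod_eq_zero_iff, sub_eq_zero, hr]
  have key : ∀ u : ℝ, (derivative (C c * ∏ r ∈ S, (X - C r))).eval u =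
      c * (-1) ^ (S.card - 1) * ∑ r ∈ S, ∏ q ∈ S.erase r, (q - u) := by
    intro u
    rw [derivative_C_mul, derivative_prod_finset, eval_C_mul, eval_finsetSum, mul_assoc c]
    congr 1
    rw [Finset.mul_sum]
    refine Finset.sum_congr rfl fun r hr => ?_
    rw [← Finset.card_erase_of_mem hr, ← Finset.prod_const, ← Finset.prod_mul_distrib]
    simp [eval_prod]
  rw [key, key, abs_mul, abs_mul (c * _)]
  have h0 : ∀ r ∈ S, 0 ≤ ∏ q ∈ S.erase r, (q - t) := fun r _ =>
    Finset.prod_nonneg fun q hq => sub_nonneg.2 (hS q (Finset.mem_of_mem_erase hq))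
  rw [abs_of_nonneg (Finset.sum_nonneg h0)]
  refine mul_le_mul_of_nonneg_left ?_ (abs_nonneg _)
  refine le_trans (Finset.sum_le_sum fun r hr => ?_) (le_abs_self _)
  refine Finset.prod_le_prod (fun q hq => sub_nonneg.2 (hS q (Finset.mem_of_mem_erase hq)))
    fun q hq => by linarith

theorem sub_le (h : JacobiSolution κ a b l y) {x z : ℝ} (hg : IsGap y x z) :
    z - x ≤ 2 * (κ : ℝ) ^ 2 / l + 2 * Real.pi * √((1 + z) * (1 - x)) / √l := by
  have ha := h.pos_left
  have hb := h.pos_right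
  have hl : 0 < l := by linarith [h.two_le]
  have hx := hg.neg_one_le
  have hz := hg.le_one
  set ρ := (κ : ℝ) ^ 2 / l with hρ
  have hρ0 : 0 < ρ := by have := h.one_le_kappa; positivity
  set D := 2 * Real.pi * √((1 + z) * (1 - x)) / √l with hD
  have hD0 : 0 ≤ D := by positivity
  have e : 2 * (κ : ℝ) ^ 2 / l = 2 * ρ := by rw [hρ]; ring
  rw [e]
  by_contra! hcon
  set x' := max x (-1 + ρ)
  set z' := min z (1 - ρ)
  have hx' : x' ≤ x + ρ := max_le (by linarith) (by linarith)
  have hz' : z - ρ ≤ z' := le_min (by linarith) (by linarith)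
  have hx1 : x ≤ x' := le_max_left _ _
  have hx2 : -1 + ρ ≤ x' := le_max_right _ _
  have hz1 : z' ≤ z := min_le_left _ _
  have hz2 : z' ≤ 1 - ρ := min_le_right _ _
  obtain ⟨η, hη⟩ : ∃ η, η = (z' - x' - D) / 4 := ⟨_, rfl⟩
  have hη0 : 0 < η := by rw [hη]; linarith
  have := h.ode.sub_le_of_ne_zero ha hb hl (x := x' + η) (z := z' - η) (by linarith) (by linarith)
    (by linarith) (fun t ht => hg.ne_zero t ⟨by linarith [ht.1], by linarith [ht.2]⟩)
    (by
      intro t ht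
      have h1 : ρ ≤ 1 + t := by linarith [ht.1]
      have h2 : ρ ≤ 1 - t := by linarith [ht.2]
      have h3 : ρ ≤ 1 - t ^ 2 := by
        rcases le_total 0 t with h0 | h0 <;> nlinarith
      have h4 : (2 * a + 2 * b + 1) ^ 2 ≤ (κ : ℝ) ^ 2 := by
        have := h.le_kappa
        gcongr
      have h5 : l * ρ = (κ : ℝ) ^ 2 := by rw [hρ]; field_simp
      nlinarith)
  have h1 : √((1 + (z' - η)) * (1 - (x' + η))) ≤ √((1 + z) * (1 - x)) := by
    apply Real.sqrt_le_sqrt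
    apply mul_le_mul <;> linarith
  have h2 : √l * (z' - η - (x' + η)) ≤ 2 * Real.pi * √((1 + z) * (1 - x)) :=
    this.trans (by gcongr)
  have h3 : z' - η - (x' + η) ≤ D := by
    rw [hD, le_div_iff₀ (Real.sqrt_pos.2 hl)]
    linarith
  linarith

theorem mul_sq_sub_le (h : JacobiSolution κ a b l y) {x z : ℝ} (hg : IsGap y x z) :
    l * (z - x) ^ 2 ≤ 8 * (κ : ℝ) ^ 4 / l + 80 * ((1 + z) * (1 - x)) := by
  have hl : 0 < l := by linarith [h.two_le]
  have hP : 0 ≤ (1 + z) * (1 - x) :=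
    mul_nonneg (by linarith [hg.neg_one_le, hg.lt]) (by linarith [hg.le_one, hg.lt])
  have hsub : 0 ≤ z - x := by linarith [hg.lt]
  have h1 : (z - x) ^ 2 ≤ (2 * (κ : ℝ) ^ 2 / l + 2 * Real.pi * √((1 + z) * (1 - x)) / √l) ^ 2 := by
    have := h.sub_le hg
    gcongr
  have h2 : (2 * Real.pi * √((1 + z) * (1 - x)) / √l) ^ 2 =
      4 * Real.pi ^ 2 * ((1 + z) * (1 - x)) / l := by
    rw [div_pow, mul_pow, Real.sq_sqrt hP, Real.sq_sqrt hl.le]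
    ring
  have hpi : Real.pi ^ 2 ≤ 10 := by nlinarith [Real.pi_lt_d2, Real.pi_pos]
  have h3 : (z - x) ^ 2 ≤ 2 * (2 * (κ : ℝ) ^ 2 / l) ^ 2 +
      2 * (4 * Real.pi ^ 2 * ((1 + z) * (1 - x)) / l) := by
    rw [← h2]
    exact h1.trans add_sq_le |>.trans (by linarith)
  have h4 : l * (2 * (2 * (κ : ℝ) ^ 2 / l) ^ 2 + 2 * (4 * Real.pi ^ 2 * ((1 + z) * (1 - x)) / l)) =
      8 * (κ : ℝ) ^ 4 / l + 8 * Real.pi ^ 2 * ((1 + z) * (1 - x)) := by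
    field_simp
    ring
  have h5 := mul_le_mul_of_nonneg_left h3 hl.le
  rw [h4] at h5
  have h6 : Real.pi ^ 2 * ((1 + z) * (1 - x)) ≤ 10 * ((1 + z) * (1 - x)) := by gcongr
  linarith

theorem sub_le' (h : JacobiSolution κ a b l y) {x z : ℝ} (hg : IsGap y x z) :
    z - x ≤ (2 * (κ : ℝ) ^ 2 + 40) / l + (1 + z) * (1 - x) / 4 := by
  have hl : 0 < l := by linarith [h.two_le]
  have hP : 0 ≤ (1 + z) * (1 - x) :=
    mul_nonneg (by linarith [hg.neg_one_le, hg.lt]) (by linarith [hg.le_one, hg.lt])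
  have h1 := h.sub_le hg
  have h2 : 2 * Real.pi * √((1 + z) * (1 - x)) / √l ≤
      (1 + z) * (1 - x) / 4 + 4 * Real.pi ^ 2 / l := by
    have := sq_nonneg (√((1 + z) * (1 - x)) / 2 - 2 * Real.pi / √l)
    have e : (√((1 + z) * (1 - x)) / 2 - 2 * Real.pi / √l) ^ 2 =
        √((1 + z) * (1 - x)) ^ 2 / 4 + 4 * Real.pi ^ 2 / √l ^ 2 -
        2 * Real.pi * √((1 + z) * (1 - x)) / √l := by ring
    rw [e, Real.sq_sqrt hP, Real.sq_sqrt hl.le] at this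
    linarith
  have hpi : Real.pi ^ 2 ≤ 10 := by nlinarith [Real.pi_lt_d2, Real.pi_pos]
  have h3 : 4 * Real.pi ^ 2 / l ≤ 40 / l := by
    gcongr; linarith
  rw [add_div]
  linarith

theorem one_add_le (h : JacobiSolution κ a b l y) {x z : ℝ} (hg : IsGap y x z) :
    1 + z ≤ 2 * (1 + x) + (4 * (κ : ℝ) ^ 2 + 80) / l := by
  have h1 := h.sub_le' hg
  have h2 : (1 + z) * (1 - x) ≤ (1 + z) * 2 := by
    apply mul_le_mul_of_nonneg_left <;> linarith [hg.neg_one_le, hg.lt]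
  have h3 : (4 * (κ : ℝ) ^ 2 + 80) / l = 2 * ((2 * (κ : ℝ) ^ 2 + 40) / l) := by ring
  linarith

theorem derivative_neg_one (h : JacobiSolution κ a b l y) :
    (2 * b + 2) * (derivative y).eval (-1) = -(l * y.eval (-1)) := by
  have := h.ode (-1)
  linarith

theorem abs_derivative_neg_one_le (h : JacobiSolution κ a b l y) :
    |(derivative y).eval (-1)| ≤ l * |y.eval (-1)| / 2 := by
  have hl : 0 < l := by linarith [h.two_le]
  have hb := h.pos_right
  have := congrArg abs h.derivative_neg_one
  rw [abs_neg, abs_mul, abs_mul, abs_of_pos hl, abs_of_pos (by linarith : 0 < 2 * b + 2)] at this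
  nlinarith [abs_nonneg ((derivative y).eval (-1))]

/-- The roots stay away from `-1`: to the left of the first root `|y'|` is at most
`|y'(-1)| ≤ l |y(-1)| / 2`. -/
theorem two_le_mul_one_add (h : JacobiSolution κ a b l y) {r : ℝ} (hr : y.eval r = 0) :
    2 ≤ l * (1 + r) := by
  have hl : 0 < l := by linarith [h.two_le]
  have hy0 : y ≠ 0 := by
    rintro rfl
    obtain ⟨t, -, ht⟩ := h.exists_ne_zero
    simp at ht
  obtain ⟨m, hm, hmin⟩ := Finset.exists_min_image y.roots.toFinset id
    ⟨r, by simpa [hy0] using hr⟩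
  simp only [Multiset.mem_toFinset, mem_roots', ne_eq, hy0, not_false_eq_true, IsRoot.def,
    true_and, id] at hm hmin
  have hmI := h.mem_Ioo_of_root hm
  have hne : y.eval (-1) ≠ 0 := fun h0 => by simpa using (h.mem_Ioo_of_root h0).1
  have h1 := abs_eval_sub_le (y := y) (p := -1) (q := m)
    (M := |(derivative y).eval (-1)|) hmI.1.le
    (fun t ht => h.abs_derivative_le ht.1 fun s hs => ht.2.trans (hmin s hs))
  rw [hm, zero_sub, abs_neg] at h1
  have h2 := h.abs_derivative_neg_one_le
  have h3 : 0 < |y.eval (-1)| := abs_pos.2 hne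
  have h4 : |y.eval (-1)| ≤ l * |y.eval (-1)| / 2 * (m - -1) :=
    h1.trans (mul_le_mul_of_nonneg_right h2 (by linarith [hmI.1]))
  have h5 : 2 ≤ l * (1 + m) := by
    by_contra! hlt
    nlinarith
  have := hmin r hr
  nlinarith

theorem two_le_mul_one_sub (h : JacobiSolution κ a b l y) {r : ℝ} (hr : y.eval r = 0) :
    2 ≤ l * (1 - r) := by
  have := h.reflect.two_le_mul_one_add (r := -r) (by simpa using hr)
  linarith

theorem two_le_mul_one_sub_sq (h : JacobiSolution κ a b l y) {r : ℝ} (hr : y.eval r = 0) :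
    2 ≤ l * (1 - r ^ 2) := by
  have h1 := h.two_le_mul_one_add hr
  have h2 := h.two_le_mul_one_sub hr
  have hl : 0 < l := by linarith [h.two_le]
  rcases le_total 0 r with h0 | h0 <;> nlinarith [mul_nonneg hl.le (abs_nonneg r)]

theorem one_add_le_mul (h : JacobiSolution κ a b l y) {x z : ℝ} (hg : IsGap y x z)
    (hx : y.eval x = 0) : 1 + z ≤ (2 * (κ : ℝ) ^ 2 + 42) * (1 + x) := by
  have hl : 0 < l := by linarith [h.two_le]
  have h1 := h.one_add_le hg
  have h2 := h.two_le_mul_one_add hx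
  have h3 : (4 * (κ : ℝ) ^ 2 + 80) / l ≤ (2 * (κ : ℝ) ^ 2 + 40) * (1 + x) := by
    rw [div_le_iff₀ hl]
    nlinarith [sq_nonneg (κ : ℝ)]
  linarith

theorem one_sub_le_mul (h : JacobiSolution κ a b l y) {x z : ℝ} (hg : IsGap y x z)
    (hz : y.eval z = 0) : 1 - x ≤ (2 * (κ : ℝ) ^ 2 + 42) * (1 - z) := by
  have := h.reflect.one_add_le_mul hg.reflect (by simpa using hz)
  linarith

theorem energy_comparable (h : JacobiSolution κ a b l y) {p q A B : ℝ} (hp : -1 < p) (hpq : p ≤ q)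
    (hq : q < 1) (hA : 1 + q ≤ A * (1 + p)) (hB : 1 - p ≤ B * (1 - q)) :
    jacobiEnergy l y p ≤ (A * B) ^ κ * jacobiEnergy l y q ∧
      jacobiEnergy l y q ≤ (A * B) ^ κ * jacobiEnergy l y p := by
  have hl : 0 < l := by linarith [h.two_le]
  have h1 : 0 < 1 + p := by linarith
  have h2 : 0 < 1 - q := by linarith
  have h3 : 0 < 1 - p := by linarith
  have h4 : 0 < 1 + q := by linarith
  have hE : ∀ t, -1 < t → t < 1 → 0 ≤ jacobiEnergy l y t := by
    intro t ht1 ht2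
    have : 0 ≤ 1 - t ^ 2 := by nlinarith
    simp only [jacobiEnergy]
    positivity
  have hr : ((1 + q) * (1 - p) / ((1 + p) * (1 - q))) ^ κ ≤ (A * B) ^ κ := by
    gcongr
    rw [div_le_iff₀ (by positivity)]
    calc (1 + q) * (1 - p) ≤ (A * (1 + p)) * (B * (1 - q)) := by
          gcongr
          linarith
      _ = _ := by ring
  constructor
  · refine (h.ode.energy_le h.pos_left h.pos_right hl h.le_kappa hp hpq hq).trans ?_
    rw [mul_comm]
    exact mul_le_mul_of_nonneg_right hr (hE q (by linarith) hq)
  · refine (h.ode.energy_le' h.pos_left h.pos_right hl h.le_kappa hp hpq hq).trans ?_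
    rw [mul_comm]
    exact mul_le_mul_of_nonneg_right hr (hE p hp (by linarith))

theorem derivative_ne_zero (h : JacobiSolution κ a b l y) {r : ℝ} (hr : y.eval r = 0) :
    (derivative y).eval r ≠ 0 := by
  intro hd
  have hl : 0 < l := by linarith [h.two_le]
  have hE : jacobiEnergy l y r = 0 := by simp [jacobiEnergy, hr, hd]
  obtain ⟨hr1, hr2⟩ := h.mem_Ioo_of_root hr
  obtain ⟨t, ⟨ht1, ht2⟩, hyt⟩ := h.exists_ne_zero
  have hEt : 0 < jacobiEnergy l y t := by
    have : 0 < 1 - t ^ 2 := by nlinarith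
    simp only [jacobiEnergy]
    positivity
  rcases le_total r t with hrt | hrt
  · have := h.ode.energy_le' h.pos_left h.pos_right hl h.le_kappa hr1 hrt ht2
    rw [hE] at this
    linarith
  · have := h.ode.energy_le h.pos_left h.pos_right hl h.le_kappa ht1 hrt hr2
    rw [hE] at this
    linarith

/-- Between adjacent roots all values of the energy are comparable. -/
theorem energy_le_mul (h : JacobiSolution κ a b l y) {x z : ℝ} (hg : IsGap y x z)
    (hx : y.eval x = 0) (hz : y.eval z = 0) {s t : ℝ} (hs : s ∈ Set.Icc x z)
    (ht : t ∈ Set.Icc x z) :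
    jacobiEnergy l y t ≤ ((2 * (κ : ℝ) ^ 2 + 42) ^ 2) ^ κ * jacobiEnergy l y s := by
  have hA := h.one_add_le_mul hg hx
  have hB := h.one_sub_le_mul hg hz
  obtain ⟨hx1, -⟩ := h.mem_Ioo_of_root hx
  obtain ⟨-, hz1⟩ := h.mem_Ioo_of_root hz
  set A := 2 * (κ : ℝ) ^ 2 + 42
  have hA0 : 0 ≤ A := by positivity
  have key : ∀ p q, x ≤ p → p ≤ q → q ≤ z →
      jacobiEnergy l y p ≤ (A ^ 2) ^ κ * jacobiEnergy l y q ∧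
      jacobiEnergy l y q ≤ (A ^ 2) ^ κ * jacobiEnergy l y p := by
    intro p q hp hpq hq
    rw [sq]
    exact h.energy_comparable (by linarith) hpq (by linarith) (by nlinarith) (by nlinarith)
  rcases le_total s t with hst | hst
  · exact (key s t hs.1 hst ht.2).2
  · exact (key t s ht.1 hst hs.2).1

end JacobiSolution

/-! ### Size of a solution near its zeros -/

namespace JacobiSolution

variable {κ : ℕ} {a b l : ℝ} {y : ℝ[X]}

/-- The derivative on the gap to the right of `-1` is controlled by the derivative at the first
root: `|y'(-1)|` is of order `l |y(-1)|`, at distance `1 / l` from `-1` the solution is still of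
size `|y(-1)|`, and from there on the energy is comparable with the energy at the root. -/
theorem sq_derivative_neg_one_le (h : JacobiSolution κ a b l y) {z : ℝ} (hg : IsGap y (-1) z)
    (hz : y.eval z = 0) :
    (derivative y).eval (-1) ^ 2 ≤ 2 * (4 * (κ : ℝ) ^ 2 + 80) *
      ((4 * (κ : ℝ) ^ 2 + 80) * (2 * (κ : ℝ) ^ 2 + 42)) ^ κ * (derivative y).eval z ^ 2 := by
  have hl : 0 < l := by linarith [h.two_le]
  obtain ⟨hz1, hz2⟩ := h.mem_Ioo_of_root hz
  set A := 4 * (κ : ℝ) ^ 2 + 80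
  have hA0 : 0 < A := by positivity
  set B := 2 * (κ : ℝ) ^ 2 + 42
  have hfirst : ∀ r, y.eval r = 0 → z ≤ r := by
    intro r hr
    by_contra! hlt
    exact hg.ne_zero r ⟨(h.mem_Ioo_of_root hr).1, hlt⟩ hr
  have hD := h.abs_derivative_neg_one_le
  have hz3 : 1 + z ≤ A / l := by
    have := h.one_add_le hg
    linarith
  have hz4 : 1 + z ≤ A * (1 + (-1 + 1 / l)) := hz3.trans (le_of_eq (by ring))
  have hz5 := h.two_le_mul_one_add hz
  have hsz : -1 + 1 / l ≤ z := by
    have : 1 / l ≤ 1 + z := by rw [div_le_iff₀ hl]; linarith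
    linarith
  have hil : 0 < 1 / l := by positivity
  have hB : 1 - (-1 + 1 / l) ≤ B * (1 - z) := by
    have := h.one_sub_le_mul hg hz
    linarith
  have hE := (h.energy_comparable (by linarith) hsz hz2 hz4 hB).1
  have hyS : |y.eval (-1)| / 2 ≤ |y.eval (-1 + 1 / l)| := by
    have h1 := abs_eval_sub_le (y := y) (p := -1) (q := -1 + 1 / l)
      (M := |(derivative y).eval (-1)|) (by linarith)
      (fun t ht => h.abs_derivative_le ht.1 fun s hs => (ht.2.trans hsz).trans (hfirst s hs))
    have h2 : |(derivative y).eval (-1)| * (-1 + 1 / l - -1) ≤ |y.eval (-1)| / 2 := by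
      have e : -1 + 1 / l - -1 = 1 / l := by ring
      rw [e, mul_one_div, div_le_iff₀ hl]
      linarith
    have h3 := abs_sub_abs_le_abs_sub (y.eval (-1)) (y.eval (-1 + 1 / l))
    rw [abs_sub_comm] at h3
    linarith
  have hEs : l * (|y.eval (-1)| / 2) ^ 2 ≤ jacobiEnergy l y (-1 + 1 / l) := by
    have h1 : (|y.eval (-1)| / 2) ^ 2 ≤ y.eval (-1 + 1 / l) ^ 2 := by
      rw [← sq_abs (y.eval (-1 + 1 / l))]
      gcongr
    have h2 : 0 ≤ 1 - (-1 + 1 / l) ^ 2 := by nlinarith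
    have h3 : 0 ≤ (1 - (-1 + 1 / l) ^ 2) * (derivative y).eval (-1 + 1 / l) ^ 2 := by positivity
    simp only [jacobiEnergy]
    nlinarith
  have hEz : jacobiEnergy l y z ≤ 2 * A / l * (derivative y).eval z ^ 2 := by
    have h1 : 1 - z ^ 2 ≤ 2 * A / l := by
      have : 2 * A / l = 2 * (A / l) := by ring
      rw [this]
      nlinarith
    simp only [jacobiEnergy, hz]
    have := mul_le_mul_of_nonneg_right h1 (sq_nonneg ((derivative y).eval z))
    linarith
  have h6 : l * (|y.eval (-1)| / 2) ^ 2 ≤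
      (A * B) ^ κ * (2 * A / l * (derivative y).eval z ^ 2) :=
    (hEs.trans hE).trans (by gcongr)
  have h7 : (derivative y).eval (-1) ^ 2 ≤ l * (l * (|y.eval (-1)| / 2) ^ 2) := by
    have : l * (l * (|y.eval (-1)| / 2) ^ 2) = (l * |y.eval (-1)| / 2) ^ 2 := by ring
    rw [this, ← sq_abs]
    gcongr
  refine h7.trans ((mul_le_mul_of_nonneg_left h6 hl.le).trans (le_of_eq ?_))
  field_simp

theorem exists_sq_derivative_le (κ : ℕ) : ∃ D : ℝ, 1 ≤ D ∧ ∀ {a b l : ℝ} {y : ℝ[X]},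
    JacobiSolution κ a b l y → ∀ {x z : ℝ}, IsGap y x z → y.eval z = 0 → ∀ t ∈ Set.Icc x z,
      (derivative y).eval t ^ 2 ≤ D * (derivative y).eval z ^ 2 := by
  set A := 4 * (κ : ℝ) ^ 2 + 80 with hA
  set B := 2 * (κ : ℝ) ^ 2 + 42 with hB
  have hB1 : 1 ≤ B := by nlinarith [sq_nonneg (κ : ℝ)]
  have hP : 1 ≤ (B ^ 2) ^ κ := one_le_pow₀ (one_le_pow₀ hB1)
  have hQ : 0 ≤ 2 * A * (A * B) ^ κ := by positivity
  refine ⟨(B ^ 2) ^ κ * B + 2 * A * (A * B) ^ κ, by nlinarith, ?_⟩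
  intro a b l y h x z hg hz t ht
  have hl : 0 < l := by linarith [h.two_le]
  have hv := sq_nonneg ((derivative y).eval z)
  rcases hg.left with rfl | hx
  · have h1 : |(derivative y).eval t| ≤ |(derivative y).eval (-1)| := by
      refine h.abs_derivative_le ht.1 fun r hr => ht.2.trans ?_
      by_contra! hlt
      exact hg.ne_zero r ⟨(h.mem_Ioo_of_root hr).1, hlt⟩ hr
    have h2 := h.sq_derivative_neg_one_le hg hz
    have h3 := sq_le_sq.2 h1
    have : 0 ≤ (B ^ 2) ^ κ * B * (derivative y).eval z ^ 2 := by positivity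
    linarith
  · have hE := h.energy_le_mul hg hx hz (Set.right_mem_Icc.2 hg.lt.le) ht
    rw [← hB] at hE
    obtain ⟨hz1, hz2⟩ := h.mem_Ioo_of_root hz
    obtain ⟨hx1, hx2⟩ := h.mem_Ioo_of_root hx
    have h1 : 1 - z ^ 2 ≤ B * (1 - t ^ 2) := by
      have h2 := h.one_add_le_mul hg hx
      rw [← hB] at h2
      calc 1 - z ^ 2 = (1 + z) * (1 - z) := by ring
        _ ≤ (B * (1 + t)) * (1 - t) := by
          apply mul_le_mul _ (by linarith [ht.2]) (by linarith) (by nlinarith [ht.1])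
          nlinarith [ht.1]
        _ = _ := by ring
    have h2 : 0 < 1 - t ^ 2 := by nlinarith [ht.1, ht.2]
    have h3 : (1 - t ^ 2) * (derivative y).eval t ^ 2 ≤
        (1 - t ^ 2) * ((B ^ 2) ^ κ * B * (derivative y).eval z ^ 2) := by
      calc (1 - t ^ 2) * (derivative y).eval t ^ 2 ≤ jacobiEnergy l y t := by
            simp only [jacobiEnergy]
            have : 0 ≤ l * y.eval t ^ 2 := by positivity
            linarith
        _ ≤ (B ^ 2) ^ κ * jacobiEnergy l y z := hE
        _ = (B ^ 2) ^ κ * ((1 - z ^ 2) * (derivative y).eval z ^ 2) := by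
            simp [jacobiEnergy, hz]
        _ ≤ (B ^ 2) ^ κ * ((B * (1 - t ^ 2)) * (derivative y).eval z ^ 2) := by gcongr
        _ = _ := by ring
    have h4 := le_of_mul_le_mul_left h3 h2
    have : 0 ≤ 2 * A * (A * B) ^ κ * (derivative y).eval z ^ 2 := by positivity
    linarith

/-- The length of a gap next to a root `z` is of order `√((1 - z²) / l)`. -/
theorem exists_gap_comparable (κ : ℕ) : ∃ D : ℝ, 1 ≤ D ∧ ∀ {a b l : ℝ} {y : ℝ[X]},
    JacobiSolution κ a b l y → ∀ {x z : ℝ}, IsGap y x z → y.eval z = 0 →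
      l * (z - x) ^ 2 ≤ D * (1 - z ^ 2) ∧ 1 - z ^ 2 ≤ D * (l * (z - x) ^ 2) := by
  set B := 2 * (κ : ℝ) ^ 2 + 42 with hB
  have hB1 : 1 ≤ B := by nlinarith [sq_nonneg (κ : ℝ)]
  have hP : 1 ≤ (B ^ 2) ^ κ := one_le_pow₀ (one_le_pow₀ hB1)
  have hP' : 1 ≤ B * (B ^ 2) ^ κ := one_le_mul_of_one_le_of_one_le hB1 hP
  have hκ : 0 ≤ (κ : ℝ) ^ 4 := by positivity
  refine ⟨4 * (κ : ℝ) ^ 4 + 80 * B + B * (B ^ 2) ^ κ, by linarith, ?_⟩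
  intro a b l y h x z hg hz
  have hl : 0 < l := by linarith [h.two_le]
  obtain ⟨hz1, hz2⟩ := h.mem_Ioo_of_root hz
  have hpos : 0 < 1 - z ^ 2 := by nlinarith
  have h2 := h.two_le_mul_one_sub_sq hz
  have hb := h.one_sub_le_mul hg hz
  rw [← hB] at hb
  have hsq : 0 ≤ l * (z - x) ^ 2 := by positivity
  constructor
  · have h1 := h.mul_sq_sub_le hg
    have h3 : 8 * (κ : ℝ) ^ 4 / l ≤ 4 * (κ : ℝ) ^ 4 * (1 - z ^ 2) := by
      rw [div_le_iff₀ hl]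
      nlinarith
    have h4 : (1 + z) * (1 - x) ≤ (1 + z) * (B * (1 - z)) := by gcongr; linarith
    nlinarith
  · suffices hs : 1 - z ^ 2 ≤ B * (B ^ 2) ^ κ * (l * (z - x) ^ 2) by
      have : 0 ≤ (4 * (κ : ℝ) ^ 4 + 80 * B) * (l * (z - x) ^ 2) := by positivity
      linarith
    rcases hg.left with rfl | hx
    · have h3 := h.two_le_mul_one_add hz
      have h4 : 2 * (1 + z) ≤ l * (1 + z) * (1 + z) := by
        apply mul_le_mul_of_nonneg_right h3; linarith
      have h5 : 1 - z ^ 2 ≤ 2 * (1 + z) := by nlinarith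
      have h6 : l * (z - -1) ^ 2 = l * (1 + z) * (1 + z) := by ring
      rw [h6] at hsq ⊢
      nlinarith
    · have hx1 := (h.mem_Ioo_of_root hx).1
      -- a critical point `ξ` between the two roots: there the energy is `l y(ξ)²`
      obtain ⟨ξ, hξ, hξ0⟩ := exists_hasDerivAt_eq_zero (f := fun t => y.eval t)
        (f' := fun t => (derivative y).eval t) hg.lt y.continuous.continuousOn
        (by rw [hx, hz]) (fun t _ => y.hasDerivAt t)
      obtain ⟨η, hη, hη0⟩ := exists_hasDerivAt_eq_slope (fun t => y.eval t)
        (fun t => (derivative y).eval t) hξ.1 y.continuous.continuousOn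
        (fun t _ => y.hasDerivAt t)
      have hξx : 0 < ξ - x := sub_pos.2 hξ.1
      rw [hx, sub_zero, eq_div_iff hξx.ne'] at hη0
      have hyξ : y.eval ξ ≠ 0 := hg.ne_zero ξ hξ
      have hvη : (derivative y).eval η ≠ 0 := by
        intro h0
        rw [h0, zero_mul] at hη0
        exact hyξ hη0.symm
      have hηz : η < z := hη.2.trans hξ.2
      have hE := h.energy_le_mul hg hx hz (s := ξ) (t := η) ⟨hξ.1.le, hξ.2.le⟩ ⟨hη.1.le, hηz.le⟩
      rw [← hB] at hE
      have h3 : (1 - η ^ 2) * (derivative y).eval η ^ 2 ≤ jacobiEnergy l y η := by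
        simp only [jacobiEnergy]
        have : 0 ≤ l * y.eval η ^ 2 := by positivity
        linarith
      have h4 : jacobiEnergy l y ξ = l * (ξ - x) ^ 2 * (derivative y).eval η ^ 2 := by
        simp only [jacobiEnergy, hξ0, ← hη0]
        ring
      have h5 : 1 - η ^ 2 ≤ (B ^ 2) ^ κ * (l * (ξ - x) ^ 2) := by
        refine le_of_mul_le_mul_right ?_ (sq_pos_of_ne_zero hvη)
        rw [h4] at hE
        linarith
      have h6 : (ξ - x) ^ 2 ≤ (z - x) ^ 2 := by
        have := hξ.2.le
        gcongr
      have h7 : 1 - z ^ 2 ≤ B * (1 - η ^ 2) := by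
        have h8 := h.one_add_le_mul hg hx
        rw [← hB] at h8
        calc 1 - z ^ 2 = (1 + z) * (1 - z) := by ring
          _ ≤ (B * (1 + η)) * (1 - η) := by
            apply mul_le_mul _ (by linarith) (by linarith) (by nlinarith [hη.1])
            nlinarith [hη.1]
          _ = _ := by ring
      calc 1 - z ^ 2 ≤ B * ((B ^ 2) ^ κ * (l * (ξ - x) ^ 2)) := h7.trans (by gcongr)
        _ ≤ B * ((B ^ 2) ^ κ * (l * (z - x) ^ 2)) := by gcongr
        _ = _ := by ring

/-- Near a root `z`, on a fixed proportion of the gap to its left, the solution is at least as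
large as half its tangent. -/
theorem exists_sq_eval_ge (κ : ℕ) : ∃ c : ℝ, 0 < c ∧ c ≤ 1 / 2 ∧ ∀ {a b l : ℝ} {y : ℝ[X]},
    JacobiSolution κ a b l y → ∀ {x z : ℝ}, IsGap y x z → y.eval z = 0 →
      ∀ t ∈ Set.Icc (z - c * (z - x)) z,
        (derivative y).eval z ^ 2 * (t - z) ^ 2 ≤ 4 * y.eval t ^ 2 := by
  obtain ⟨D, hD, hder⟩ := exists_sq_derivative_le κ
  obtain ⟨G, hG, hgap⟩ := exists_gap_comparable κ
  set M := 2 * G * ((κ + 1) * G + 1) with hM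
  have hM0 : 1 ≤ M := by
    have : 0 ≤ (κ + 1 : ℝ) * G := by positivity
    rw [hM]
    nlinarith
  have hM1 : 1 ≤ M * D := one_le_mul_of_one_le_of_one_le hM0 hD
  refine ⟨1 / (2 * (M * D)), by positivity, ?_, ?_⟩
  · rw [div_le_div_iff₀ (by positivity) (by norm_num)]
    linarith
  intro a b l y h x z hg hz t ht
  have hl : 0 < l := by linarith [h.two_le]
  obtain ⟨hz1, hz2⟩ := h.mem_Ioo_of_root hz
  have hx1 := hg.neg_one_le
  obtain ⟨g, hgdef⟩ : ∃ g, g = z - x := ⟨_, rfl⟩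
  have hg0 : 0 < g := by rw [hgdef]; linarith [hg.lt]
  obtain ⟨hgap1, hgap2⟩ := hgap h hg hz
  rw [← hgdef] at hgap1 hgap2 ht
  have hδ : 1 / (2 * (M * D)) * g ≤ g / 2 := by
    rw [div_mul_eq_mul_div, one_mul]
    gcongr
    linarith
  have hlg : 1 ≤ G * (l * g) := by
    have h2 := h.two_le_mul_one_sub_sq hz
    have h3 : l * (1 - z ^ 2) ≤ G * (l * g) * (l * g) := by nlinarith
    by_contra! hlt
    have : 0 < l * g := by positivity
    nlinarith
  set V := |(derivative y).eval z| with hV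
  have hV0 : 0 ≤ V := abs_nonneg _
  have hD1 : ∀ s ∈ Set.Icc x z, |(derivative y).eval s| ≤ D * V := by
    intro s hs
    have h1 := hder h hg hz s hs
    refine abs_le_of_sq_le_sq' ?_ (by positivity) |> abs_le.2
    have : (D * V) ^ 2 = D * (D * (derivative y).eval z ^ 2) := by
      rw [mul_pow, hV, sq_abs]; ring
    rw [this]
    have h0 : 0 ≤ D * (derivative y).eval z ^ 2 := by positivity
    nlinarith
  have hD2 : ∀ s ∈ Set.Icc (z - g / 2) z, |(derivative (derivative y)).eval s| ≤ M * D * V / g := by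
    intro s hs
    have hsx : x ≤ s := by linarith [hs.1]
    have hsz := hs.2
    have h1 := hD1 s ⟨hsx, hsz⟩
    have h2 : |y.eval s| ≤ g * (D * V) := by
      have := abs_eval_sub_le (y := y) (p := s) (q := z) (M := D * V) hsz
        (fun u hu => hD1 u ⟨hsx.trans hu.1, hu.2⟩)
      rw [hz, zero_sub, abs_neg] at this
      refine this.trans ?_
      rw [mul_comm g]
      gcongr
      linarith
    have hs0 : 0 < 1 + s := by linarith [hs.1]
    have h3 : 0 < 1 - s ^ 2 := by nlinarith
    have h4 : 1 - z ^ 2 ≤ 2 * (1 - s ^ 2) := by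
      calc 1 - z ^ 2 = (1 + z) * (1 - z) := by ring
        _ ≤ (2 * (1 + s)) * (1 - s) := by
          apply mul_le_mul <;> linarith [hs.1]
        _ = _ := by ring
    have h5 : |b - a - (a + b + 2) * s| ≤ κ + 1 := by
      have := abs_drift_le (t := s) h.pos_left h.pos_right (by linarith) (by linarith)
      have hk := h.le_kappa
      rw [abs_le] at this ⊢
      constructor <;> nlinarith
    have h6 : (1 - s ^ 2) * |(derivative (derivative y)).eval s| ≤
        (κ + 1) * (D * V) + l * (g * (D * V)) := by
      have := h.ode s
      have e : (1 - s ^ 2) * (derivative (derivative y)).eval s =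
        -((b - a - (a + b + 2) * s) * (derivative y).eval s + l * y.eval s) := by linarith
      rw [← abs_of_pos h3, ← abs_mul, e, abs_neg]
      refine (abs_add_le _ _).trans ?_
      rw [abs_mul, abs_mul, abs_of_pos hl]
      gcongr
    have h7 : (κ + 1) * (D * V) + l * (g * (D * V)) ≤ ((κ + 1) * G + 1) * (l * g) * (D * V) := by
      have h8 : (κ + 1) * (D * V) * 1 ≤ (κ + 1) * (D * V) * (G * (l * g)) := by gcongr
      linarith
    have h9 : l * g ^ 2 ≤ 2 * G * (1 - s ^ 2) := by nlinarith
    rw [le_div_iff₀ hg0]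
    have h10 : (l * g) * (|(derivative (derivative y)).eval s| * g) ≤ (l * g) * (M * D * V) := by
      calc (l * g) * (|(derivative (derivative y)).eval s| * g)
          = (l * g ^ 2) * |(derivative (derivative y)).eval s| := by ring
        _ ≤ (2 * G * (1 - s ^ 2)) * |(derivative (derivative y)).eval s| := by gcongr
        _ = 2 * G * ((1 - s ^ 2) * |(derivative (derivative y)).eval s|) := by ring
        _ ≤ 2 * G * (((κ + 1) * G + 1) * (l * g) * (D * V)) := by
            exact mul_le_mul_of_nonneg_left (h6.trans h7) (by positivity)
        _ = _ := by rw [hM]; ring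
    exact le_of_mul_le_mul_left h10 (by positivity)
  have hhalf : ∀ s ∈ Set.Icc t z, V / 2 ≤ |(derivative y).eval s| := by
    intro s hs
    have hs1 : z - g / 2 ≤ s := by linarith [ht.1, hs.1]
    have h1 := abs_eval_sub_le (y := derivative y) (p := s) (q := z)
      (M := M * D * V / g) hs.2 (fun u hu => hD2 u ⟨hs1.trans hu.1, hu.2⟩)
    have h2 : M * D * V / g * (z - s) ≤ V / 2 := by
      calc M * D * V / g * (z - s) ≤ M * D * V / g * (1 / (2 * (M * D)) * g) := by
            gcongr
            linarith [ht.1, hs.1]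
        _ = V / 2 := by field_simp
    have h3 := abs_sub_abs_le_abs_sub ((derivative y).eval z) ((derivative y).eval s)
    linarith
  rcases eq_or_lt_of_le ht.2 with rfl | htz
  · simp [sq_nonneg]
  obtain ⟨η, hη, hη0⟩ := exists_hasDerivAt_eq_slope (fun t => y.eval t)
    (fun t => (derivative y).eval t) htz y.continuous.continuousOn (fun t _ => y.hasDerivAt t)
  rw [hz, zero_sub, eq_div_iff (sub_pos.2 htz).ne'] at hη0
  have h1 := hhalf η ⟨hη.1.le, hη.2.le⟩
  have h2 : (derivative y).eval z ^ 2 ≤ 4 * (derivative y).eval η ^ 2 := by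
    rw [← sq_abs, ← sq_abs ((derivative y).eval η), ← hV]
    nlinarith
  have h3 : y.eval t ^ 2 = (derivative y).eval η ^ 2 * (t - z) ^ 2 := by
    rw [← neg_sq, ← hη0]; ring
  rw [h3, ← mul_assoc]
  gcongr

/-- Upper bound for the solution on the gap to the left of a root `z`. The factor `t - x` comes
from the zero of `(1 - t²) y` at `x`. -/
theorem exists_sq_eval_le (κ : ℕ) : ∃ D : ℝ, 1 ≤ D ∧ ∀ {a b l : ℝ} {y : ℝ[X]},
    JacobiSolution κ a b l y → ∀ {x z : ℝ}, IsGap y x z → y.eval z = 0 → ∀ t ∈ Set.Icc x z,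
      (1 - t ^ 2) * y.eval t ^ 2 * (z - x) ≤
        D * ((1 - z ^ 2) * (derivative y).eval z ^ 2 * (z - t) ^ 2 * (t - x)) := by
  obtain ⟨D, hD, hder⟩ := exists_sq_derivative_le κ
  set B := 2 * (κ : ℝ) ^ 2 + 42 with hB
  have hB1 : 1 ≤ B := by nlinarith [sq_nonneg (κ : ℝ)]
  refine ⟨B * (2 * D ^ 2), by
    have : 1 ≤ 2 * D ^ 2 := by nlinarith
    exact one_le_mul_of_one_le_of_one_le hB1 this, ?_⟩
  intro a b l y h x z hg hz t ht
  obtain ⟨hz1, hz2⟩ := h.mem_Ioo_of_root hz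
  have hx1 := hg.neg_one_le
  set V := |(derivative y).eval z| with hV
  have hV0 : 0 ≤ V := abs_nonneg _
  have hD1 : ∀ s ∈ Set.Icc x z, |(derivative y).eval s| ≤ D * V := by
    intro s hs
    have h1 := hder h hg hz s hs
    refine abs_le_of_sq_le_sq' ?_ (by positivity) |> abs_le.2
    have : (D * V) ^ 2 = D * (D * (derivative y).eval z ^ 2) := by
      rw [mul_pow, hV, sq_abs]; ring
    rw [this]
    have h0 : 0 ≤ D * (derivative y).eval z ^ 2 := by positivity
    nlinarith
  have hb := h.one_sub_le_mul hg hz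
  rw [← hB] at hb
  have hu : 0 ≤ t - x := by linarith [ht.1]
  have hv : 0 ≤ z - t := by linarith [ht.2]
  have hyv : y.eval t ^ 2 ≤ (D * V * (z - t)) ^ 2 := by
    have := abs_eval_sub_le (y := y) (p := t) (q := z) (M := D * V) ht.2
      (fun u hu => hD1 u ⟨ht.1.trans hu.1, hu.2⟩)
    rw [hz, zero_sub, abs_neg] at this
    rw [← sq_abs]
    gcongr
  have hDV : D ^ 2 * V ^ 2 = D ^ 2 * (derivative y).eval z ^ 2 := by rw [hV, sq_abs]
  rcases hg.left with rfl | hx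
  · have h1 : (1 - t ^ 2) * (z - -1) ≤ B * (1 - z ^ 2) * (2 * (t - -1)) := by
      have h2 : (1 - t) * ((1 + t) * (1 + z)) ≤ (B * (1 - z)) * ((1 + t) * (1 + z)) := by
        gcongr
        · exact mul_nonneg (by linarith) (by linarith)
        · linarith
      have : 0 ≤ (B * (1 - z)) * ((1 + t) * (1 + z)) :=
        mul_nonneg (mul_nonneg (by linarith) (by linarith)) (mul_nonneg (by linarith) (by linarith))
      nlinarith
    calc (1 - t ^ 2) * y.eval t ^ 2 * (z - -1) = ((1 - t ^ 2) * (z - -1)) * y.eval t ^ 2 := by ring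
      _ ≤ (B * (1 - z ^ 2) * (2 * (t - -1))) * (D * V * (z - t)) ^ 2 := by
          apply mul_le_mul h1 hyv (sq_nonneg _)
          have : 0 ≤ 1 - z ^ 2 := by nlinarith
          positivity
      _ = B * (1 - z ^ 2) * (2 * (t - -1)) * (D ^ 2 * V ^ 2) * (z - t) ^ 2 := by ring
      _ = _ := by rw [hDV]; ring
  · have hyu : y.eval t ^ 2 ≤ (D * V * (t - x)) ^ 2 := by
      have := abs_eval_sub_le (y := y) (p := x) (q := t) (M := D * V) ht.1
        (fun u hu => hD1 u ⟨hu.1, hu.2.trans ht.2⟩)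
      rw [hx, sub_zero] at this
      rw [← sq_abs]
      gcongr
    -- `min (u, v)² (u + v) ≤ 2 u v²` for the distances `u`, `v` of `t` to the two roots
    have hmin : y.eval t ^ 2 * (z - x) ≤ (D * V) ^ 2 * (2 * ((z - t) ^ 2 * (t - x))) := by
      have e : z - x = (z - t) + (t - x) := by ring
      rw [e]
      set u := t - x
      set v := z - t
      rw [mul_pow] at hyu hyv
      rcases le_total u v with huv | huv
      · calc y.eval t ^ 2 * (v + u) ≤ (D * V) ^ 2 * u ^ 2 * (v + v) := by gcongr
          _ = (D * V) ^ 2 * (2 * ((u * v) * u)) := by ring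
          _ ≤ (D * V) ^ 2 * (2 * ((v * v) * u)) := by gcongr
          _ = _ := by ring
      · calc y.eval t ^ 2 * (v + u) ≤ (D * V) ^ 2 * v ^ 2 * (u + u) := by gcongr
          _ = _ := by ring
    have h1 : 1 - t ^ 2 ≤ B * (1 - z ^ 2) := by
      calc 1 - t ^ 2 = (1 - t) * (1 + t) := by ring
        _ ≤ (B * (1 - z)) * (1 + z) := by
          apply mul_le_mul <;> nlinarith [ht.1, ht.2]
        _ = _ := by ring
    have h0 : 0 ≤ 1 - z ^ 2 := by nlinarith
    calc (1 - t ^ 2) * y.eval t ^ 2 * (z - x) = (1 - t ^ 2) * (y.eval t ^ 2 * (z - x)) := by ring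
      _ ≤ (B * (1 - z ^ 2)) * ((D * V) ^ 2 * (2 * ((z - t) ^ 2 * (t - x)))) := by
        apply mul_le_mul h1 hmin _ (by positivity)
        have := hg.lt
        exact mul_nonneg (sq_nonneg _) (by linarith)
      _ = B * (1 - z ^ 2) * (2 * ((z - t) ^ 2 * (t - x))) * (D ^ 2 * V ^ 2) := by ring
      _ = _ := by rw [hDV]; ring

/-- The bound for the solution on the first gap that controls the weight of the node `-1`. -/
theorem exists_sq_eval_le_neg_one (κ : ℕ) : ∃ D : ℝ, 1 ≤ D ∧ ∀ {a b l : ℝ} {y : ℝ[X]},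
    JacobiSolution κ a b l y → ∀ {z : ℝ}, IsGap y (-1) z → y.eval z = 0 →
      ∀ t ∈ Set.Icc (-1) z,
        (1 - t) * y.eval t ^ 2 * (1 + z) ≤ D * (2 * y.eval (-1) ^ 2 * (z - t)) := by
  set A := 4 * (κ : ℝ) ^ 2 + 80 with hA
  have hA1 : 2 ≤ A := by nlinarith [sq_nonneg (κ : ℝ)]
  refine ⟨A ^ 2 / 4, by nlinarith, ?_⟩
  intro a b l y h z hg hz t ht
  have hl : 0 < l := by linarith [h.two_le]
  obtain ⟨hz1, hz2⟩ := h.mem_Ioo_of_root hz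
  have hD := h.abs_derivative_neg_one_le
  have hz3 : l * (1 + z) ≤ A := by
    have := h.one_add_le hg
    have h1 : 1 + z ≤ A / l := by linarith
    rw [le_div_iff₀ hl] at h1
    linarith
  have h1 : |y.eval t| ≤ l * |y.eval (-1)| / 2 * (z - t) := by
    have := abs_eval_sub_le (y := y) (p := t) (q := z) (M := |(derivative y).eval (-1)|)
      ht.2 (fun u hu => h.abs_derivative_le (ht.1.trans hu.1) fun r hr => hu.2.trans (by
        by_contra! hlt
        exact hg.ne_zero r ⟨(h.mem_Ioo_of_root hr).1, hlt⟩ hr))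
    rw [hz, zero_sub, abs_neg] at this
    refine this.trans ?_
    have := ht.2
    gcongr
  have hv : 0 ≤ z - t := by linarith [ht.2]
  have h2 : y.eval t ^ 2 ≤ (l * |y.eval (-1)| / 2 * (z - t)) ^ 2 := by
    rw [← sq_abs]; gcongr
  have e : (l * |y.eval (-1)| / 2 * (z - t)) ^ 2 =
      l ^ 2 * y.eval (-1) ^ 2 / 4 * (z - t) * (z - t) := by
    rw [← sq_abs (y.eval (-1))]; ring
  have h3 : y.eval t ^ 2 ≤ l ^ 2 * y.eval (-1) ^ 2 / 4 * (z - t) * (1 + z) := by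
    rw [e] at h2
    refine h2.trans ?_
    gcongr
    linarith [ht.1]
  have h4 : (l * (1 + z)) ^ 2 ≤ A ^ 2 := by
    gcongr
    exact mul_nonneg hl.le (by linarith)
  calc (1 - t) * y.eval t ^ 2 * (1 + z)
      ≤ 2 * (l ^ 2 * y.eval (-1) ^ 2 / 4 * (z - t) * (1 + z)) * (1 + z) := by
        have := ht.1
        gcongr
        · linarith
        · linarith
    _ = (l * (1 + z)) ^ 2 / 4 * (2 * y.eval (-1) ^ 2 * (z - t)) := by ring
    _ ≤ A ^ 2 / 4 * (2 * y.eval (-1) ^ 2 * (z - t)) := by gcongr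

end JacobiSolution

/-! ### Orthogonal polynomials for the Jacobi weight -/

theorem jacobiWeight_pos (γ δ : ℝ) {t : ℝ} (ht : t ∈ Set.Ioo (-1 : ℝ) 1) :
    0 < jacobiWeight γ δ t :=
  mul_pos (Real.rpow_pos_of_pos (by linarith [ht.2]) _)
    (Real.rpow_pos_of_pos (by linarith [ht.1]) _)

theorem jacobiWeight_nonneg (γ δ : ℝ) {t : ℝ} (ht : t ∈ Set.Icc (-1 : ℝ) 1) :
    0 ≤ jacobiWeight γ δ t :=
  mul_nonneg (Real.rpow_nonneg (by linarith [ht.2]) _) (Real.rpow_nonneg (by linarith [ht.1]) _)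

theorem intervalIntegrable_one_sub_rpow {γ : ℝ} (hγ : -1 < γ) (p q : ℝ) :
    IntervalIntegrable (fun t : ℝ => (1 - t) ^ γ) MeasureTheory.volume p q := by
  have := (intervalIntegral.intervalIntegrable_rpow' hγ (a := 1 - p) (b := 1 - q)).comp_sub_left 1
  simpa using this

theorem intervalIntegrable_one_add_rpow {δ : ℝ} (hδ : -1 < δ) (p q : ℝ) :
    IntervalIntegrable (fun t : ℝ => (1 + t) ^ δ) MeasureTheory.volume p q := by
  have := (intervalIntegral.intervalIntegrable_rpow' hδ (a := 1 + p) (b := 1 + q)).comp_add_left 1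
  simpa using this

theorem intervalIntegrable_jacobiWeight {γ δ : ℝ} (hγ : -1 < γ) (hδ : -1 < δ) :
    IntervalIntegrable (jacobiWeight γ δ) MeasureTheory.volume (-1) 1 := by
  have h1 : IntervalIntegrable (jacobiWeight γ δ) MeasureTheory.volume (-1) 0 := by
    refine (intervalIntegrable_one_add_rpow hδ (-1) 0).continuousOn_mul (g := fun t => (1 - t) ^ γ) ?_
    intro t ht
    rw [Set.uIcc_of_le (by norm_num)] at ht
    refine ContinuousAt.continuousWithinAt (ContinuousAt.rpow_const (by fun_prop) (Or.inl ?_))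
    linarith [ht.2]
  have h2 : IntervalIntegrable (jacobiWeight γ δ) MeasureTheory.volume 0 1 := by
    refine (intervalIntegrable_one_sub_rpow hγ 0 1).mul_continuousOn (g := fun t => (1 + t) ^ δ) ?_
    intro t ht
    rw [Set.uIcc_of_le (by norm_num)] at ht
    refine ContinuousAt.continuousWithinAt (ContinuousAt.rpow_const (by fun_prop) (Or.inl ?_))
    linarith [ht.1]
  exact h1.trans h2

theorem intervalIntegrable_eval_mul_jacobiWeight {γ δ : ℝ} (hγ : -1 < γ) (hδ : -1 < δ) (p : ℝ[X]) :
    IntervalIntegrable (fun t => p.eval t * jacobiWeight γ δ t) MeasureTheory.volume (-1) 1 :=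
  (intervalIntegrable_jacobiWeight hγ hδ).continuousOn_mul p.continuous.continuousOn

/-- The integral of a polynomial against the Jacobi weight, as a linear functional. -/
noncomputable def jacobiFunctional {γ δ : ℝ} (hγ : -1 < γ) (hδ : -1 < δ) : ℝ[X] →ₗ[ℝ] ℝ where
  toFun p := ∫ t in (-1 : ℝ)..1, p.eval t * jacobiWeight γ δ t
  map_add' p q := by
    simp only [eval_add, add_mul]
    exact intervalIntegral.integral_add (intervalIntegrable_eval_mul_jacobiWeight hγ hδ p)
      (intervalIntegrable_eval_mul_jacobiWeight hγ hδ q)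
  map_smul' c p := by
    simp only [eval_smul, smul_eq_mul, mul_assoc, RingHom.id_apply]
    exact intervalIntegral.integral_const_mul _ _

section Orthogonality

variable {γ δ : ℝ} (hγ : -1 < γ) (hδ : -1 < δ)

theorem jacobiFunctional_apply (p : ℝ[X]) :
    jacobiFunctional hγ hδ p = ∫ t in (-1 : ℝ)..1, p.eval t * jacobiWeight γ δ t := rfl

theorem jacobiInner_eq (p q : ℝ[X]) : jacobiInner γ δ p q = jacobiFunctional hγ hδ (p * q) := by
  simp [jacobiInner, jacobiFunctional_apply]

theorem jacobiFunctional_C_mul (c : ℝ) (p : ℝ[X]) :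
    jacobiFunctional hγ hδ (C c * p) = c * jacobiFunctional hγ hδ p := by
  rw [← smul_eq_C_mul, map_smul, smul_eq_mul]

theorem jacobiFunctional_pos {p : ℝ[X]} (hp : p ≠ 0)
    (h0 : ∀ t ∈ Set.Ioo (-1 : ℝ) 1, 0 ≤ p.eval t) : 0 < jacobiFunctional hγ hδ p := by
  rw [jacobiFunctional_apply, intervalIntegral.integral_of_le (by norm_num),
    MeasureTheory.integral_Ioc_eq_integral_Ioo,
    MeasureTheory.setIntegral_pos_iff_support_of_nonneg_ae]
  · have : Set.Ioo (-1 : ℝ) 1 \ (p.roots.toFinset : Set ℝ) ⊆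
        (Function.support fun t => p.eval t * jacobiWeight γ δ t) ∩ Set.Ioo (-1 : ℝ) 1 := by
      rintro t ⟨ht, hn⟩
      refine ⟨mul_ne_zero (fun h => hn ?_) (jacobiWeight_pos γ δ ht).ne', ht⟩
      simpa [hp] using h
    refine lt_of_lt_of_le ?_ (MeasureTheory.measure_mono this)
    rw [MeasureTheory.measure_sdiff_null (Finset.measure_zero _ _)]
    simp
  · filter_upwards [MeasureTheory.self_mem_ae_restrict measurableSet_Ioo] with t ht
    exact mul_nonneg (h0 t ht) (jacobiWeight_pos γ δ ht).le
  · have := intervalIntegrable_eval_mul_jacobiWeight hγ hδ p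
    rw [intervalIntegrable_iff_integrableOn_Ioo_of_le (by norm_num)] at this
    exact this

theorem eq_zero_of_jacobiFunctional_mul_self {p : ℝ[X]}
    (h : jacobiFunctional hγ hδ (p * p) = 0) : p = 0 := by
  by_contra hp
  refine (jacobiFunctional_pos hγ hδ (mul_ne_zero hp hp) fun t _ => ?_).ne' h
  rw [eval_mul]
  exact mul_self_nonneg _

/-- The defining properties of the Gram-Schmidt recursion. -/
theorem jacobiMonic_spec (n : ℕ) : (jacobiMonic γ δ n).Monic ∧
    (jacobiMonic γ δ n).natDegree = n ∧ ∀ k < n,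
      jacobiFunctional hγ hδ (jacobiMonic γ δ n * jacobiMonic γ δ k) = 0 := by
  induction n using Nat.strong_induction_on with
  | _ n ih =>
    have hrec := jacobiMonic.eq_1 γ δ n
    set s := ∑ k : Fin n, C (jacobiInner γ δ (X ^ n) (jacobiMonic γ δ k.1) /
      jacobiInner γ δ (jacobiMonic γ δ k.1) (jacobiMonic γ δ k.1)) * jacobiMonic γ δ k.1 with hs
    have hdeg : s.degree < n := by
      refine (degree_sum_le _ _).trans_lt ((Finset.sup_lt_iff (WithBot.bot_lt_coe n)).2 ?_)
      intro k _
      rw [← smul_eq_C_mul]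
      refine (degree_smul_le _ _).trans_lt ?_
      rw [degree_eq_natDegree (ih k k.2).1.ne_zero, (ih k k.2).2.1]
      exact Nat.cast_lt.2 k.2
    have hmonic : (jacobiMonic γ δ n).Monic := by
      rw [hrec]
      exact monic_X_pow_sub hdeg
    refine ⟨hmonic, ?_, ?_⟩
    · rw [hrec]
      apply natDegree_eq_of_degree_eq_some
      rw [degree_sub_eq_left_of_degree_lt (by simpa using hdeg), degree_X_pow]
    · intro k hk
      have hkk : jacobiInner γ δ (jacobiMonic γ δ k) (jacobiMonic γ δ k) ≠ 0 := by
        rw [jacobiInner_eq hγ hδ]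
        exact fun h => (ih k hk).1.ne_zero (eq_zero_of_jacobiFunctional_mul_self hγ hδ h)
      rw [hrec, sub_mul, map_sub, hs, Finset.sum_mul, map_sum,
        Finset.sum_eq_single (⟨k, hk⟩ : Fin n)]
      · rw [mul_assoc, jacobiFunctional_C_mul, ← jacobiInner_eq, ← jacobiInner_eq,
          div_mul_cancel₀ _ hkk, sub_self]
      · intro j _ hj
        have hjk : j.1 ≠ k := fun h => hj (Fin.ext h)
        rw [mul_assoc, jacobiFunctional_C_mul]
        rcases lt_or_gt_of_ne hjk with h | h
        · rw [mul_comm (jacobiMonic γ δ j.1), (ih k hk).2.2 j h, mul_zero]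
        · rw [(ih j j.2).2.2 k h, mul_zero]
      · simp

theorem monic_jacobiMonic (hγ : -1 < γ) (hδ : -1 < δ) (n : ℕ) : (jacobiMonic γ δ n).Monic := (jacobiMonic_spec hγ hδ n).1

theorem natDegree_jacobiMonic (hγ : -1 < γ) (hδ : -1 < δ) (n : ℕ) : (jacobiMonic γ δ n).natDegree = n :=
  (jacobiMonic_spec hγ hδ n).2.1

theorem jacobiFunctional_jacobiMonic_mul {n : ℕ} {q : ℝ[X]} (hq : q.degree < n) :
    jacobiFunctional hγ hδ (jacobiMonic γ δ n * q) = 0 := by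
  suffices H : ∀ d ≤ n, ∀ q : ℝ[X], q.degree < d →
      jacobiFunctional hγ hδ (jacobiMonic γ δ n * q) = 0 from H n le_rfl q hq
  intro d
  induction d with
  | zero =>
    intro _ q hq
    have : q = 0 := by simpa using hq
    rw [this, mul_zero, map_zero]
  | succ d ih =>
    intro hd q hq
    have h1 := (jacobiMonic_spec hγ hδ n).2.2 d (by omega)
    have h2 : (q - C (q.coeff d) * jacobiMonic γ δ d).degree < d := by
      rw [degree_lt_iff_coeff_zero]
      intro m hm
      rw [coeff_sub, coeff_C_mul]
      rcases eq_or_lt_of_le hm with rfl | hm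
      · have := (monic_jacobiMonic hγ hδ d).coeff_natDegree
        rw [natDegree_jacobiMonic hγ hδ] at this
        rw [this]; ring
      · rw [coeff_eq_zero_of_natDegree_lt (p := jacobiMonic γ δ d)
          (by rw [natDegree_jacobiMonic hγ hδ]; exact hm), (degree_lt_iff_coeff_zero _ _).1 hq m (by omega)]
        ring
    have h3 := ih (by omega) _ h2
    rw [mul_sub, map_sub, mul_left_comm, jacobiFunctional_C_mul, h1, mul_zero, sub_zero] at h3
    exact h3

/-- The Jacobi differential operator without its eigenvalue term. -/
noncomputable def jacobiOperator (a b : ℝ) (p : ℝ[X]) : ℝ[X] :=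
  (1 - X ^ 2) * derivative (derivative p) + (C (b - a) - C (a + b + 2) * X) * derivative p

theorem eval_jacobiOperator (a b : ℝ) (p : ℝ[X]) (t : ℝ) : (jacobiOperator a b p).eval t =
    (1 - t ^ 2) * (derivative (derivative p)).eval t +
      (b - a - (a + b + 2) * t) * (derivative p).eval t := by
  simp [jacobiOperator]

theorem coeff_jacobiOperator (a b : ℝ) {p : ℝ[X]} {n : ℕ} (hp : p.natDegree ≤ n) {m : ℕ}
    (hm : n ≤ m) : (jacobiOperator a b p).coeff m = -(m * (m + a + b + 1) * p.coeff m) := by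
  have h1 : p.coeff (m + 1) = 0 := coeff_eq_zero_of_natDegree_lt (by omega)
  have h2 : p.coeff (m + 1 + 1) = 0 := coeff_eq_zero_of_natDegree_lt (by omega)
  have e : jacobiOperator a b p = derivative (derivative p) - X * (X * derivative (derivative p)) +
      C (b - a) * derivative p - C (a + b + 2) * (X * derivative p) := by
    rw [jacobiOperator]; ring
  rw [e]
  simp only [coeff_add, coeff_sub, coeff_C_mul]
  rcases m with _ | _ | m
  · simp [coeff_derivative, h1, h2, mul_coeff_zero]
  · simp [coeff_derivative, coeff_X_mul, h1, h2, mul_coeff_zero]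
    ring_nf
    simp
  · simp [coeff_derivative, coeff_X_mul, h1, h2]
    ring

theorem hasDerivAt_jacobiWeight_succ (a b : ℝ) {t : ℝ} (ht : t ∈ Set.Ioo (-1 : ℝ) 1) :
    HasDerivAt (jacobiWeight (a + 1) (b + 1))
      ((b - a - (a + b + 2) * t) * jacobiWeight a b t) t := by
  have h1 : 0 < 1 - t := by linarith [ht.2]
  have h2 : 0 < 1 + t := by linarith [ht.1]
  have d1 := ((hasDerivAt_id t).const_sub 1).rpow_const (p := a + 1) (Or.inl h1.ne')
  have d2 := ((hasDerivAt_id t).const_add 1).rpow_const (p := b + 1) (Or.inl h2.ne')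
  refine (d1.mul d2).congr_deriv ?_
  simp only [id, jacobiWeight, add_sub_cancel_right, Real.rpow_add_one h1.ne',
    Real.rpow_add_one h2.ne']
  ring

theorem jacobiWeight_succ (a b : ℝ) {t : ℝ} (ht : t ∈ Set.Ioo (-1 : ℝ) 1) :
    jacobiWeight (a + 1) (b + 1) t = (1 - t ^ 2) * jacobiWeight a b t := by
  have h1 : 0 < 1 - t := by linarith [ht.2]
  have h2 : 0 < 1 + t := by linarith [ht.1]
  simp only [jacobiWeight, Real.rpow_add_one h1.ne', Real.rpow_add_one h2.ne']
  ring

/-- The Jacobi operator is symmetric: `(L p) q w - p (L q) w` is the derivative of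
`(1 - t²) w (p' q - p q')`, which vanishes at `±1`. -/
theorem jacobiFunctional_jacobiOperator_comm (p q : ℝ[X]) :
    jacobiFunctional hγ hδ (jacobiOperator γ δ p * q) =
      jacobiFunctional hγ hδ (jacobiOperator γ δ q * p) := by
  rw [← sub_eq_zero, ← map_sub, jacobiFunctional_apply]
  rw [intervalIntegral.integral_eq_sub_of_hasDerivAt_of_le (by norm_num)
    (f := fun t => jacobiWeight (γ + 1) (δ + 1) t *
      ((derivative p).eval t * q.eval t - (derivative q).eval t * p.eval t))]
  · have h1 : (γ + 1) ≠ 0 := by linarith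
    have h2 : (δ + 1) ≠ 0 := by linarith
    simp [jacobiWeight, Real.zero_rpow h1, Real.zero_rpow h2]
  · refine ContinuousOn.mul (ContinuousOn.mul ?_ ?_) ?_
    · exact ContinuousOn.rpow_const (by fun_prop) fun t _ => Or.inr (by linarith)
    · exact ContinuousOn.rpow_const (by fun_prop) fun t _ => Or.inr (by linarith)
    · exact ((derivative p).continuous.mul q.continuous |>.sub
        ((derivative q).continuous.mul p.continuous)).continuousOn
  · intro t ht
    have h := (hasDerivAt_jacobiWeight_succ γ δ ht).mul
      ((((derivative p).hasDerivAt t).mul (q.hasDerivAt t)).sub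
        (((derivative q).hasDerivAt t).mul (p.hasDerivAt t)))
    refine h.congr_deriv ?_
    rw [jacobiWeight_succ γ δ ht, eval_sub, eval_mul, eval_mul, eval_jacobiOperator,
      eval_jacobiOperator]
    simp only [Pi.mul_apply, Pi.sub_apply]
    ring
  · exact intervalIntegrable_eval_mul_jacobiWeight hγ hδ _

/-- The Jacobi differential equation. With `L` the symmetric Jacobi operator, `L y + l y` has
degree less than `n` and is orthogonal to all polynomials of degree less than `n`. -/
theorem solvesJacobi_jacobiMonic (hγ : -1 < γ) (hδ : -1 < δ) (n : ℕ) :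
    SolvesJacobi γ δ (n * (n + γ + δ + 1)) (jacobiMonic γ δ n) := by
  set y := jacobiMonic γ δ n with hy
  set l : ℝ := n * (n + γ + δ + 1) with hl
  have hyn : y.natDegree = n := natDegree_jacobiMonic hγ hδ n
  set p := jacobiOperator γ δ y + C l * y with hp
  have hdeg : p.degree < n := by
    rw [degree_lt_iff_coeff_zero]
    intro m hm
    rw [hp, coeff_add, coeff_C_mul, coeff_jacobiOperator γ δ hyn.le hm]
    rcases eq_or_lt_of_le hm with rfl | hm
    · rw [hl]; ring
    · rw [coeff_eq_zero_of_natDegree_lt (by rw [hyn]; exact hm)]; ring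
  have hLp : (jacobiOperator γ δ p).degree < n := by
    rw [degree_lt_iff_coeff_zero]
    intro m hm
    rw [coeff_jacobiOperator γ δ (natDegree_le_of_degree_le hdeg.le) hm,
      (degree_lt_iff_coeff_zero _ _).1 hdeg m hm]
    ring
  have hp0 : p = 0 := by
    apply eq_zero_of_jacobiFunctional_mul_self hγ hδ
    nth_rewrite 1 [hp]
    rw [add_mul, map_add, jacobiFunctional_jacobiOperator_comm, mul_comm _ y,
      jacobiFunctional_jacobiMonic_mul hγ hδ hLp, mul_assoc, jacobiFunctional_C_mul,
      jacobiFunctional_jacobiMonic_mul hγ hδ hdeg, mul_zero, add_zero]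
  intro t
  have := congrArg (eval t) hp0
  rw [hp, eval_add, eval_mul, eval_C, eval_jacobiOperator, eval_zero] at this
  exact this

/-- A nonzero polynomial gets a constant sign on `(-1, 1)` when it is multiplied by linear factors
at finitely many distinct roots of its own. -/
theorem exists_prod_mul_nonneg {p : ℝ[X]} (hp : p ≠ 0) : ∃ (S : Finset ℝ) (ε : ℝ), ε ≠ 0 ∧
    (∀ s ∈ S, s ∈ Set.Ioo (-1 : ℝ) 1 ∧ p.eval s = 0) ∧
    ∀ t ∈ Set.Ioo (-1 : ℝ) 1, 0 ≤ (p * (C ε * ∏ s ∈ S, (X - C s))).eval t := by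
  induction hn : p.natDegree generalizing p with
  | zero =>
    obtain ⟨c, rfl⟩ := natDegree_eq_zero.1 hn
    refine ⟨∅, c, fun h => hp (by rw [h, C_0]), by simp, fun t _ => ?_⟩
    simpa using mul_self_nonneg c
  | succ n ih =>
    by_cases hroot : ∃ s ∈ Set.Ioo (-1 : ℝ) 1, p.eval s = 0
    · obtain ⟨s, hs, hs0⟩ := hroot
      obtain ⟨q, rfl⟩ := dvd_iff_isRoot.2 hs0
      have hq : q ≠ 0 := right_ne_zero_of_mul hp
      rw [natDegree_mul (X_sub_C_ne_zero s) hq, natDegree_X_sub_C] at hn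
      obtain ⟨S, ε, hε, hS, hsign⟩ := ih hq (by omega)
      by_cases hsS : s ∈ S
      · refine ⟨S.erase s, ε, hε, fun r hr => ⟨(hS r (Finset.mem_of_mem_erase hr)).1, ?_⟩,
          fun t ht => ?_⟩
        · rw [eval_mul, (hS r (Finset.mem_of_mem_erase hr)).2, mul_zero]
        · have := hsign t ht
          rw [← Finset.mul_prod_erase S _ hsS] at this
          convert this using 2
          ring
      · refine ⟨insert s S, ε, hε, fun r hr => ?_, fun t ht => ?_⟩
        · rcases Finset.mem_insert.1 hr with rfl | hr
          · exact ⟨hs, hs0⟩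
          · exact ⟨(hS r hr).1, by rw [eval_mul, (hS r hr).2, mul_zero]⟩
        · have h1 := mul_nonneg (sq_nonneg (t - s)) (hsign t ht)
          rw [Finset.prod_insert hsS]
          simp only [eval_mul, eval_sub, eval_X, eval_C] at h1 ⊢
          linarith
    · push Not at hroot
      refine ⟨∅, p.eval 0, hroot 0 (by norm_num), by simp, fun t ht => ?_⟩
      simp only [Finset.prod_empty, mul_one, eval_mul, eval_C]
      by_contra! hlt
      have hivt : ∃ s ∈ Set.Ioo (-1 : ℝ) 1, p.eval s = 0 := by
        have hconn := (isPreconnected_Ioo (a := (-1 : ℝ)) (b := 1)).intermediate_value₂ ht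
          (show (0 : ℝ) ∈ Set.Ioo (-1 : ℝ) 1 by norm_num)
          (f := fun u => p.eval u * p.eval 0) (g := fun _ => 0)
          ((p.continuous.mul continuous_const).continuousOn) continuousOn_const hlt.le
          (mul_self_nonneg _)
        obtain ⟨s, hs, hs0⟩ := hconn
        exact ⟨s, hs, (mul_eq_zero.1 hs0).resolve_right (hroot 0 (by norm_num))⟩
      obtain ⟨s, hs, hs0⟩ := hivt
      exact hroot s hs hs0

/-- The orthogonal polynomial of degree `n` has `n` distinct roots in `(-1, 1)`: otherwise it
would be orthogonal to a polynomial of lower degree that makes the product nonnegative. -/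
theorem jacobiMonic_eq_prod (hγ : -1 < γ) (hδ : -1 < δ) (n : ℕ) : ∃ S : Finset ℝ, S.card = n ∧
    jacobiMonic γ δ n = ∏ r ∈ S, (X - C r) ∧ ∀ r ∈ S, r ∈ Set.Ioo (-1 : ℝ) 1 := by
  have hm := monic_jacobiMonic hγ hδ n
  have hd := natDegree_jacobiMonic hγ hδ n
  obtain ⟨S, ε, hε, hS, hsign⟩ := exists_prod_mul_nonneg hm.ne_zero
  have hprod : (∏ s ∈ S, (X - C s)).Monic := monic_prod_of_monic _ _ fun s _ => monic_X_sub_C s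
  have hprodd : (∏ s ∈ S, (X - C s)).natDegree = S.card := by
    rw [natDegree_prod_of_monic _ _ fun s _ => monic_X_sub_C s]; simp
  have hcard : n ≤ S.card := by
    by_contra! hlt
    refine (jacobiFunctional_pos hγ hδ (mul_ne_zero hm.ne_zero
      (mul_ne_zero (C_ne_zero.2 hε) hprod.ne_zero)) hsign).ne' ?_
    apply jacobiFunctional_jacobiMonic_mul
    rw [degree_C_mul hε, degree_eq_natDegree hprod.ne_zero, hprodd]
    exact_mod_cast hlt
  have hdvd : ∏ s ∈ S, (X - C s) ∣ jacobiMonic γ δ n := by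
    apply Finset.prod_dvd_of_coprime
    · intro r _ s _ hrs
      exact isCoprime_X_sub_C_of_isUnit_sub (sub_ne_zero.2 hrs).isUnit
    · exact fun s hs => dvd_iff_isRoot.2 (hS s hs).2
  have heq := eq_of_monic_of_dvd_of_natDegree_le hprod hm hdvd (by omega)
  refine ⟨S, ?_, heq, fun r hr => (hS r hr).1⟩
  rw [← hprodd, ← heq, hd]

theorem jacobiSolution_jacobiMonic {a b : ℝ} (ha : 0 < a) (hb : 0 < b) {κ : ℕ}
    (hκ : 2 * a + 2 * b + 1 ≤ κ) {n : ℕ} (hn : 1 ≤ n) :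
    JacobiSolution κ a b (n * (n + a + b + 1)) (jacobiMonic a b n) where
  pos_left := ha
  pos_right := hb
  le_kappa := hκ
  two_le := by
    have : (1 : ℝ) ≤ n := by exact_mod_cast hn
    nlinarith
  ode := solvesJacobi_jacobiMonic (by linarith) (by linarith) n
  exists_prod := by
    obtain ⟨S, -, h, hS⟩ := jacobiMonic_eq_prod (by linarith : -1 < a) (by linarith : -1 < b) n
    exact ⟨S, 1, one_ne_zero, by rw [h, C_1, one_mul], hS⟩

end Orthogonality

/-! ### Integrals over gaps -/

section Integrals

variable {γ δ : ℝ} (hγ : -1 < γ) (hδ : -1 < δ)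

theorem intervalIntegrable_eval_mul_jacobiWeight_of_le (hγ : -1 < γ) (hδ : -1 < δ) (P : ℝ[X])
    {p q : ℝ} (hp : -1 ≤ p) (hpq : p ≤ q) (hq : q ≤ 1) :
    IntervalIntegrable (fun t => P.eval t * jacobiWeight γ δ t) MeasureTheory.volume p q := by
  refine (intervalIntegrable_eval_mul_jacobiWeight hγ hδ P).mono_set ?_
  rw [Set.uIcc_of_le hpq, Set.uIcc_of_le (by norm_num)]
  exact Set.Icc_subset_Icc hp hq

theorem intervalIntegrable_jacobiWeight_of_le (hγ : -1 < γ) (hδ : -1 < δ)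
    {p q : ℝ} (hp : -1 ≤ p) (hpq : p ≤ q) (hq : q ≤ 1) :
    IntervalIntegrable (jacobiWeight γ δ) MeasureTheory.volume p q := by
  simpa using intervalIntegrable_eval_mul_jacobiWeight_of_le hγ hδ 1 hp hpq hq

theorem jacobiFunctional_split (P : ℝ[X]) {p q : ℝ} (hp : -1 ≤ p) (hpq : p ≤ q) (hq : q ≤ 1) :
    jacobiFunctional hγ hδ P = (∫ t in (-1 : ℝ)..p, P.eval t * jacobiWeight γ δ t) +
      (∫ t in p..q, P.eval t * jacobiWeight γ δ t) +
      ∫ t in q..1, P.eval t * jacobiWeight γ δ t := by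
  have h1 := intervalIntegrable_eval_mul_jacobiWeight_of_le hγ hδ P le_rfl hp (hpq.trans hq)
  have h2 := intervalIntegrable_eval_mul_jacobiWeight_of_le hγ hδ P hp hpq hq
  have h3 := intervalIntegrable_eval_mul_jacobiWeight_of_le hγ hδ P (hp.trans hpq) hq le_rfl
  rw [jacobiFunctional_apply, intervalIntegral.integral_add_adjacent_intervals h1 h2,
    intervalIntegral.integral_add_adjacent_intervals (h1.trans h2) h3]

theorem integral_eval_mul_jacobiWeight_le (hγ : -1 < γ) (hδ : -1 < δ) {P : ℝ[X]} {p q M : ℝ}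
    (hp : -1 ≤ p) (hpq : p ≤ q) (hq : q ≤ 1) (h : ∀ t ∈ Set.Ioo p q, P.eval t ≤ M) :
    ∫ t in p..q, P.eval t * jacobiWeight γ δ t ≤ M * ∫ t in p..q, jacobiWeight γ δ t := by
  rw [← intervalIntegral.integral_const_mul]
  refine intervalIntegral.integral_mono_on_of_le_Ioo hpq
    (intervalIntegrable_eval_mul_jacobiWeight_of_le hγ hδ P hp hpq hq)
    ((intervalIntegrable_jacobiWeight_of_le hγ hδ hp hpq hq).const_mul M) fun t ht => ?_
  exact mul_le_mul_of_nonneg_right (h t ht)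
    (jacobiWeight_nonneg γ δ ⟨hp.trans ht.1.le, ht.2.le.trans hq⟩)

theorem jacobiFunctional_le {P : ℝ[X]} {p r q M : ℝ} (hp : -1 ≤ p) (hpr : p ≤ r) (hrq : r ≤ q)
    (hq : q ≤ 1) (hl : ∀ t ∈ Set.Ioo p r, P.eval t ≤ M) (hr : ∀ t ∈ Set.Ioo r q, P.eval t ≤ M)
    (hout : ∀ t, (-1 < t ∧ t < p) ∨ (q < t ∧ t < 1) → P.eval t ≤ 0) :
    jacobiFunctional hγ hδ P ≤ M * ∫ t in p..q, jacobiWeight γ δ t := by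
  have h1 := integral_eval_mul_jacobiWeight_le hγ hδ (P := P) (M := 0) le_rfl hp
    (hpr.trans (hrq.trans hq)) fun t ht => hout t (Or.inl ht)
  have h2 := integral_eval_mul_jacobiWeight_le hγ hδ (P := P) (M := 0)
    (hp.trans (hpr.trans hrq)) hq le_rfl fun t ht => hout t (Or.inr ht)
  have h3 := integral_eval_mul_jacobiWeight_le hγ hδ hp hpr (hrq.trans hq) hl
  have h4 := integral_eval_mul_jacobiWeight_le hγ hδ (hp.trans hpr) hrq hq hr
  have i1 := intervalIntegrable_eval_mul_jacobiWeight_of_le hγ hδ P hp hpr (hrq.trans hq)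
  have i2 := intervalIntegrable_eval_mul_jacobiWeight_of_le hγ hδ P (hp.trans hpr) hrq hq
  have j1 := intervalIntegrable_jacobiWeight_of_le hγ hδ hp hpr (hrq.trans hq)
  have j2 := intervalIntegrable_jacobiWeight_of_le hγ hδ (hp.trans hpr) hrq hq
  rw [jacobiFunctional_split hγ hδ P hp (hpr.trans hrq) hq,
    ← intervalIntegral.integral_add_adjacent_intervals i1 i2,
    ← intervalIntegral.integral_add_adjacent_intervals j1 j2]
  linarith

theorem le_jacobiFunctional {P : ℝ[X]} {p q M : ℝ} (hp : -1 ≤ p) (hpq : p ≤ q)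
    (hq : q ≤ 1) (hP : ∀ t, 0 ≤ P.eval t)
    (h : ∀ t ∈ Set.Ioo p q, M ≤ P.eval t * jacobiWeight γ δ t) :
    M * (q - p) ≤ jacobiFunctional hγ hδ P := by
  have h1 : 0 ≤ ∫ t in (-1 : ℝ)..p, P.eval t * jacobiWeight γ δ t :=
    intervalIntegral.integral_nonneg hp fun t ht => mul_nonneg (hP t)
      (jacobiWeight_nonneg γ δ ⟨ht.1, by linarith [ht.2]⟩)
  have h2 : 0 ≤ ∫ t in q..1, P.eval t * jacobiWeight γ δ t :=
    intervalIntegral.integral_nonneg hq fun t ht => mul_nonneg (hP t)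
      (jacobiWeight_nonneg γ δ ⟨by linarith [ht.1], ht.2⟩)
  have h3 : ∫ _ in p..q, M ≤ ∫ t in p..q, P.eval t * jacobiWeight γ δ t :=
    intervalIntegral.integral_mono_on_of_le_Ioo hpq intervalIntegrable_const
      (intervalIntegrable_eval_mul_jacobiWeight_of_le hγ hδ P hp hpq hq) h
  rw [intervalIntegral.integral_const, smul_eq_mul] at h3
  rw [jacobiFunctional_split hγ hδ P hp hpq hq]
  linarith

theorem jacobiFunctional_succ (hγ' : -1 < γ + 1) (hδ' : -1 < δ + 1) (P : ℝ[X]) :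
    jacobiFunctional hγ' hδ' P = jacobiFunctional hγ hδ ((1 - X ^ 2) * P) := by
  simp only [jacobiFunctional_apply]
  rw [intervalIntegral.integral_of_le (by norm_num), intervalIntegral.integral_of_le (by norm_num),
    MeasureTheory.integral_Ioc_eq_integral_Ioo, MeasureTheory.integral_Ioc_eq_integral_Ioo]
  refine MeasureTheory.setIntegral_congr_fun measurableSet_Ioo fun t ht => ?_
  simp only [jacobiWeight_succ γ δ ht, eval_mul, eval_sub, eval_one, eval_pow, eval_X]
  ring

end Integrals

/-! ### Comparison of the weight on a gap -/

section WeightBounds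

theorem jacobiWeight_neg (γ δ t : ℝ) : jacobiWeight γ δ (-t) = jacobiWeight δ γ t := by
  simp only [jacobiWeight, sub_neg_eq_add, ← sub_eq_add_neg]
  ring

theorem rpow_le_of_comparable {κ : ℕ} {a B u v : ℝ} (haκ : a ≤ κ) (hB : 1 ≤ B)
    (hv : 0 < v) (hvu : v ≤ u) (huv : u ≤ B * v) : u ^ a ≤ B ^ κ * v ^ a := by
  have hP : 1 ≤ B ^ κ := one_le_pow₀ hB
  rcases le_total 0 a with ha | ha
  · calc u ^ a ≤ (B * v) ^ a := Real.rpow_le_rpow (hv.le.trans hvu) huv ha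
      _ = B ^ a * v ^ a := Real.mul_rpow (by linarith) hv.le
      _ ≤ B ^ κ * v ^ a := by
        gcongr
        rw [← Real.rpow_natCast]
        exact Real.rpow_le_rpow_of_exponent_le hB haκ
  · have := Real.rpow_le_rpow_of_nonpos hv hvu ha
    have h0 : 0 ≤ v ^ a := Real.rpow_nonneg hv.le _
    nlinarith

namespace JacobiSolution

variable {κ : ℕ} {a b l : ℝ} {y : ℝ[X]}

theorem jacobiWeight_le (h : JacobiSolution κ a b l y) {x z : ℝ} (hg : IsGap y x z)
    (hz : y.eval z = 0) {t : ℝ} (ht : t ∈ Set.Icc x z) :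
    jacobiWeight a b t ≤ (2 * (κ : ℝ) ^ 2 + 42) ^ κ * jacobiWeight a b z := by
  obtain ⟨hz1, hz2⟩ := h.mem_Ioo_of_root hz
  have ha := h.pos_left
  have hb := h.pos_right
  have hk := h.le_kappa
  have hx := hg.neg_one_le
  have h1 : (1 - t) ^ a ≤ (2 * (κ : ℝ) ^ 2 + 42) ^ κ * (1 - z) ^ a :=
    rpow_le_of_comparable (by linarith) (by nlinarith [sq_nonneg (κ : ℝ)]) (by linarith)
      (by linarith [ht.2]) (by linarith [h.one_sub_le_mul hg hz, ht.1])
  have h2 : (1 + t) ^ b ≤ (1 + z) ^ b :=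
    Real.rpow_le_rpow (by linarith [ht.1]) (by linarith [ht.2]) hb.le
  have h3 : 0 ≤ (1 + t) ^ b := Real.rpow_nonneg (by linarith [ht.1]) _
  have h4 : 0 ≤ (1 - z) ^ a := Real.rpow_nonneg (by linarith) _
  calc jacobiWeight a b t ≤ ((2 * (κ : ℝ) ^ 2 + 42) ^ κ * (1 - z) ^ a) * (1 + z) ^ b := by
        unfold jacobiWeight
        gcongr
    _ = _ := by unfold jacobiWeight; ring

theorem le_jacobiWeight (h : JacobiSolution κ a b l y) {x z : ℝ} (hg : IsGap y x z)
    (hz : y.eval z = 0) {t : ℝ} (ht1 : z - (z - x) / 2 ≤ t) (ht2 : t ≤ z) :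
    jacobiWeight a b z ≤ 2 ^ κ * jacobiWeight a b t := by
  obtain ⟨hz1, hz2⟩ := h.mem_Ioo_of_root hz
  have ha := h.pos_left
  have hb := h.pos_right
  have hk := h.le_kappa
  have hx := hg.neg_one_le
  have h1 : (1 - z) ^ a ≤ (1 - t) ^ a := Real.rpow_le_rpow (by linarith) (by linarith) ha.le
  have h2 : (1 + z) ^ b ≤ 2 ^ κ * (1 + t) ^ b :=
    rpow_le_of_comparable (by linarith) (by norm_num) (by linarith) (by linarith) (by linarith)
  have h3 : 0 ≤ (1 + z) ^ b := Real.rpow_nonneg (by linarith) _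
  have h4 : 0 ≤ (1 - t) ^ a := Real.rpow_nonneg (by linarith) _
  calc jacobiWeight a b z ≤ (1 - t) ^ a * (2 ^ κ * (1 + t) ^ b) := by
        unfold jacobiWeight
        gcongr
    _ = _ := by unfold jacobiWeight; ring

/-- The mass of the weight `w^{α,β}` on the first gap. -/
theorem integral_jacobiWeight_le {α β : ℝ} (h : JacobiSolution κ (α + 1) (β + 1) l y) {z : ℝ}
    (hg : IsGap y (-1) z) (hz : y.eval z = 0) :
    ∫ t in (-1 : ℝ)..z, jacobiWeight α β t ≤
      (2 * (κ : ℝ) ^ 2 + 42) ^ κ / (β + 1) * ((z + 1) * jacobiWeight α β z) := by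
  obtain ⟨hz1, hz2⟩ := h.mem_Ioo_of_root hz
  have ha := h.pos_left
  have hb := h.pos_right
  have hk := h.le_kappa
  have hα : -1 < α := by linarith
  have hβ : -1 < β := by linarith
  set W := (2 * (κ : ℝ) ^ 2 + 42) ^ κ
  have h1 : ∫ t in (-1 : ℝ)..z, jacobiWeight α β t ≤
      ∫ t in (-1 : ℝ)..z, (W * (1 - z) ^ α) * (1 + t) ^ β := by
    refine intervalIntegral.integral_mono_on hz1.le
      (intervalIntegrable_jacobiWeight_of_le hα hβ le_rfl hz1.le hz2.le)
      ((intervalIntegrable_one_add_rpow hβ (-1) z).const_mul _) fun t ht => ?_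
    have h2 : (1 - t) ^ α ≤ W * (1 - z) ^ α :=
      rpow_le_of_comparable (by linarith) (by nlinarith [sq_nonneg (κ : ℝ)]) (by linarith)
        (by linarith [ht.2]) (by linarith [h.one_sub_le_mul hg hz, ht.1])
    have h3 : 0 ≤ (1 + t) ^ β := Real.rpow_nonneg (by linarith [ht.1]) _
    exact mul_le_mul_of_nonneg_right h2 h3
  refine h1.trans (le_of_eq ?_)
  rw [intervalIntegral.integral_const_mul,
    intervalIntegral.integral_comp_add_left (fun t => t ^ β) 1, integral_rpow (Or.inl hβ)]
  have h4 : (0 : ℝ) < 1 + z := by linarith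
  rw [add_neg_cancel, Real.zero_rpow hb.ne', Real.rpow_add_one h4.ne']
  unfold jacobiWeight
  ring

/-- The two gaps next to a root have comparable lengths. -/
theorem exists_adjacent_gaps_comparable (κ : ℕ) : ∃ D : ℝ, 1 ≤ D ∧
    ∀ {a b l : ℝ} {y : ℝ[X]}, JacobiSolution κ a b l y → ∀ {x r z : ℝ}, IsGap y x r →
      IsGap y r z → y.eval r = 0 → r - x ≤ D * (z - r) ∧ z - r ≤ D * (r - x) := by
  obtain ⟨D, hD, hgap⟩ := exists_gap_comparable κ
  refine ⟨D, hD, fun {a b l y} h {x r z} hx hz hr => ?_⟩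
  have hl : 0 < l := by linarith [h.two_le]
  obtain ⟨h1, h2⟩ := hgap h hx hr
  obtain ⟨h3, h4⟩ := hgap h.reflect hz.reflect (by simpa using hr)
  have hxr := hx.lt
  have hrz := hz.lt
  rw [neg_sq] at h3 h4
  have e : -r - -z = z - r := by ring
  rw [e] at h3 h4
  constructor
  · apply le_of_sq_le_sq _ (by nlinarith)
    refine le_of_mul_le_mul_left ?_ hl
    calc l * (r - x) ^ 2 ≤ D * (D * (l * (z - r) ^ 2)) := h1.trans (by gcongr)
      _ = _ := by ring
  · apply le_of_sq_le_sq _ (by nlinarith)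
    refine le_of_mul_le_mul_left ?_ hl
    calc l * (z - r) ^ 2 ≤ D * (D * (l * (r - x) ^ 2)) := h3.trans (by gcongr)
      _ = _ := by ring

end JacobiSolution

end WeightBounds

/-! ### Nodes and exactness of the Gauss-Lobatto rule -/

section Nodes

variable {α β : ℝ}

theorem jacobiZeros_eq_sort (hα : -1 < α) (hβ : -1 < β) (n : ℕ) : ∃ S : Finset ℝ, S.card = n ∧
    jacobiZeros (α + 1) (β + 1) n = S.sort (· ≤ ·) ∧
    (∀ r ∈ S, r ∈ Set.Ioo (-1 : ℝ) 1) ∧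
    ∀ r, (jacobiMonic (α + 1) (β + 1) n).eval r = 0 ↔ r ∈ S := by
  have ha : -1 < α + 1 := by linarith
  have hb : -1 < β + 1 := by linarith
  obtain ⟨S, hcard, hprod, hS⟩ := jacobiMonic_eq_prod ha hb n
  refine ⟨S, hcard, ?_, hS, fun r => ?_⟩
  · have h0 : 0 < jacobiInner (α + 1) (β + 1) (jacobiMonic (α + 1) (β + 1) n)
        (jacobiMonic (α + 1) (β + 1) n) := by
      have hne := (monic_jacobiMonic ha hb n).ne_zero
      rw [jacobiInner_eq ha hb]
      refine jacobiFunctional_pos ha hb (mul_ne_zero hne hne) fun t _ => ?_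
      rw [eval_mul]
      exact mul_self_nonneg _
    rw [jacobiZeros, jacobiPoly, roots_C_mul _ (one_div_ne_zero (Real.sqrt_pos.2 h0).ne'), hprod,
      roots_prod_X_sub_C, Finset.val_toFinset]
  · rw [hprod, eval_prod, Finset.prod_eq_zero_iff]
    simp [sub_eq_zero]

theorem lobattoNode_zero (α β : ℝ) (n : ℕ) : lobattoNode α β n 0 = -1 := by
  simp [lobattoNode]

theorem lobattoNode_last (α β : ℝ) (n : ℕ) : lobattoNode α β n (n + 1) = 1 := by
  simp [lobattoNode]

theorem lobattoNode_succ {S : Finset ℝ} {n : ℕ} (hcard : S.card = n)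
    (hS : jacobiZeros (α + 1) (β + 1) n = S.sort (· ≤ ·)) {k : ℕ} (hk : k < n) :
    lobattoNode α β n (k + 1) =
      (S.sort (· ≤ ·))[k]'(by rw [Finset.length_sort, hcard]; exact hk) := by
  have hlen : k < (S.sort (· ≤ ·)).length := by rw [Finset.length_sort, hcard]; exact hk
  rw [lobattoNode, if_neg (by omega), if_pos (by omega), hS, Nat.add_sub_cancel,
    List.getD_eq_getElem _ _ hlen]

theorem eval_lobattoNode (hα : -1 < α) (hβ : -1 < β) {n k : ℕ} (hk : 1 ≤ k) (hkn : k ≤ n) :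
    (jacobiMonic (α + 1) (β + 1) n).eval (lobattoNode α β n k) = 0 := by
  obtain ⟨S, hcard, hsort, hS, hroot⟩ := jacobiZeros_eq_sort hα hβ n
  obtain ⟨j, rfl⟩ := Nat.exists_eq_add_of_le' hk
  rw [hroot, lobattoNode_succ hcard hsort (by omega)]
  exact (Finset.mem_sort (· ≤ ·)).1 (List.getElem_mem _)

theorem lobattoNode_lt_succ (hα : -1 < α) (hβ : -1 < β) {n k : ℕ} (hk : k ≤ n) :
    lobattoNode α β n k < lobattoNode α β n (k + 1) := by
  obtain ⟨S, hcard, hsort, hS, hroot⟩ := jacobiZeros_eq_sort hα hβ n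
  have hmem : ∀ j, 1 ≤ j → j ≤ n → lobattoNode α β n j ∈ Set.Ioo (-1 : ℝ) 1 := fun j h1 h2 =>
    hS _ ((hroot _).1 (eval_lobattoNode hα hβ h1 h2))
  rcases Nat.eq_zero_or_pos k with rfl | hk0
  · rw [lobattoNode_zero]
    rcases Nat.eq_zero_or_pos n with rfl | hn
    · rw [lobattoNode_last]; norm_num
    · exact (hmem 1 le_rfl hn).1
  · rcases eq_or_lt_of_le hk with rfl | hlt
    · rw [lobattoNode_last]
      exact (hmem k hk0 le_rfl).2
    · obtain ⟨j, rfl⟩ := Nat.exists_eq_add_of_le' hk0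
      rw [lobattoNode_succ hcard hsort (by omega), lobattoNode_succ hcard hsort (by omega)]
      exact (Finset.sortedLT_sort S).getElem_lt_getElem_of_lt (by omega)

theorem lobattoNode_lt (hα : -1 < α) (hβ : -1 < β) {n i j : ℕ} (hij : i < j) (hj : j ≤ n + 1) :
    lobattoNode α β n i < lobattoNode α β n j := by
  induction j, hij using Nat.le_induction with
  | base => exact lobattoNode_lt_succ hα hβ (by omega)
  | succ j _ ih => exact (ih (by omega)).trans (lobattoNode_lt_succ hα hβ (by omega))

theorem lt_of_lobattoNode_lt (hα : -1 < α) (hβ : -1 < β) {n i j : ℕ} (hi : i ≤ n + 1)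
    (h : lobattoNode α β n i < lobattoNode α β n j) : i < j := by
  by_contra! hle
  rcases eq_or_lt_of_le hle with rfl | hlt
  · exact h.ne rfl
  · exact (lobattoNode_lt hα hβ hlt hi).not_gt h

theorem isGap_lobattoNode (hα : -1 < α) (hβ : -1 < β) {n k : ℕ} (hk : k ≤ n) :
    IsGap (jacobiMonic (α + 1) (β + 1) n) (lobattoNode α β n k) (lobattoNode α β n (k + 1)) where
  neg_one_le := by
    rcases Nat.eq_zero_or_pos k with rfl | hk0
    · rw [lobattoNode_zero]
    · rw [← lobattoNode_zero α β n]
      exact (lobattoNode_lt hα hβ hk0 (by omega)).le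
  lt := lobattoNode_lt_succ hα hβ hk
  le_one := by
    rcases eq_or_lt_of_le hk with rfl | hlt
    · rw [lobattoNode_last]
    · rw [← lobattoNode_last α β n]
      exact (lobattoNode_lt hα hβ (by omega) le_rfl).le
  ne_zero t ht h0 := by
    obtain ⟨S, hcard, hsort, hS, hroot⟩ := jacobiZeros_eq_sort hα hβ n
    have hmem : t ∈ S.sort (· ≤ ·) := (Finset.mem_sort _).2 ((hroot t).1 h0)
    obtain ⟨i, hi, rfl⟩ := List.getElem_of_mem hmem
    rw [Finset.length_sort, hcard] at hi
    rw [← lobattoNode_succ hcard hsort hi] at ht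
    have h1 := lt_of_lobattoNode_lt hα hβ (by omega) ht.1
    have h2 := lt_of_lobattoNode_lt hα hβ (by omega) ht.2
    omega
  left := by
    rcases Nat.eq_zero_or_pos k with rfl | hk0
    · exact Or.inl (lobattoNode_zero α β n)
    · exact Or.inr (eval_lobattoNode hα hβ hk0 hk)
  right := by
    rcases eq_or_lt_of_le hk with rfl | hlt
    · exact Or.inl (lobattoNode_last α β k)
    · exact Or.inr (eval_lobattoNode hα hβ (by omega) hlt)

theorem lobattoNode_injOn (hα : -1 < α) (hβ : -1 < β) (n : ℕ) :
    Set.InjOn (lobattoNode α β n) (Finset.range (n + 2)) := by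
  intro i hi j hj hij
  simp only [Finset.coe_range, Set.mem_Iio] at hi hj
  rcases lt_trichotomy i j with h | h | h
  · exact absurd hij (lobattoNode_lt hα hβ h (by omega)).ne
  · exact h
  · exact absurd hij (lobattoNode_lt hα hβ h (by omega)).ne'

theorem jacobiMonic_eq_prod_lobattoNode (hα : -1 < α) (hβ : -1 < β) (n : ℕ) :
    jacobiMonic (α + 1) (β + 1) n = ∏ j ∈ Finset.range n, (X - C (lobattoNode α β n (j + 1))) := by
  have ha : -1 < α + 1 := by linarith
  have hb : -1 < β + 1 := by linarith
  refine eq_of_monic_of_dvd_of_natDegree_le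
    (monic_prod_of_monic _ _ fun s _ => monic_X_sub_C _) (monic_jacobiMonic ha hb n) ?_ ?_
  · apply Finset.prod_dvd_of_coprime
    · intro i hi j hj hij
      refine isCoprime_X_sub_C_of_isUnit_sub (sub_ne_zero.2 fun h => hij ?_).isUnit
      simp only [Finset.coe_range, Set.mem_Iio] at hi hj
      have := lobattoNode_injOn hα hβ n (by simp; omega) (by simp; omega) h
      omega
    · intro j hj
      rw [Finset.mem_range] at hj
      exact dvd_iff_isRoot.2 (eval_lobattoNode hα hβ (by omega) (by omega))
  · rw [natDegree_jacobiMonic ha hb, natDegree_prod_of_monic _ _ fun s _ => monic_X_sub_C _]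
    simp

/-- Exactness of the Gauss-Lobatto rule, for polynomials of degree at most `2n + 1` that vanish at
all nodes but one. -/
theorem jacobiFunctional_eq_mul_lobattoWeight (hα : -1 < α) (hβ : -1 < β) {n k : ℕ} (hn : 1 ≤ n)
    (hk : k ≤ n + 1) {F : ℝ[X]} (hF : F.natDegree ≤ 2 * n + 1)
    (h0 : ∀ j ≤ n + 1, j ≠ k → F.eval (lobattoNode α β n j) = 0) :
    jacobiFunctional hα hβ F = F.eval (lobattoNode α β n k) * lobattoWeight α β n k := by
  have ha : -1 < α + 1 := by linarith
  have hb : -1 < β + 1 := by linarith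
  set τ := lobattoNode α β n with hτ
  set L := Lagrange.basis (Finset.range (n + 2)) τ k with hL
  have hinj := lobattoNode_injOn hα hβ n
  have hw : lobattoWeight α β n k = jacobiFunctional hα hβ L := rfl
  have hkr : k ∈ Finset.range (n + 2) := Finset.mem_range.2 (by omega)
  rw [hw, ← jacobiFunctional_C_mul, ← sub_eq_zero, ← map_sub]
  set R := F - C (F.eval (τ k)) * L with hR
  have hRdeg : R.natDegree ≤ 2 * n + 1 := by
    refine (natDegree_sub_le _ _).trans (max_le hF ((natDegree_C_mul_le _ _).trans ?_))
    rw [hL, Lagrange.natDegree_basis hinj hkr, Finset.card_range]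
    omega
  have hdvd : ∏ j ∈ Finset.range (n + 2), (X - C (τ j)) ∣ R := by
    apply Finset.prod_dvd_of_coprime
    · intro i hi j hj hij
      exact isCoprime_X_sub_C_of_isUnit_sub (sub_ne_zero.2 fun h => hij (hinj hi hj h)).isUnit
    · intro j hj
      refine dvd_iff_isRoot.2 ?_
      rw [IsRoot.def, hR, eval_sub, eval_mul, eval_C]
      rcases eq_or_ne j k with rfl | hjk
      · rw [hL, Lagrange.eval_basis_self hinj hkr]; ring
      · rw [hL, Lagrange.eval_basis_of_ne hjk.symm hj,
          h0 j (by have := Finset.mem_range.1 hj; omega) hjk]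
        ring
  obtain ⟨q, hq⟩ := hdvd
  have hnodal : ∏ j ∈ Finset.range (n + 2), (X - C (τ j)) =
      -((1 - X ^ 2) * jacobiMonic (α + 1) (β + 1) n) := by
    rw [Finset.prod_range_succ, Finset.prod_range_succ', ← jacobiMonic_eq_prod_lobattoNode hα hβ,
      hτ, lobattoNode_zero, lobattoNode_last]
    simp only [map_neg, C_1]
    ring
  rcases eq_or_ne q 0 with rfl | hq0
  · rw [hq, mul_zero, map_zero]
  have hqdeg : q.degree < n := by
    have hprod : (∏ j ∈ Finset.range (n + 2), (X - C (τ j))).Monic :=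
      monic_prod_of_monic _ _ fun s _ => monic_X_sub_C _
    have hd : (∏ j ∈ Finset.range (n + 2), (X - C (τ j))).natDegree = n + 2 := by
      rw [natDegree_prod_of_monic _ _ fun s _ => monic_X_sub_C _]; simp
    rw [hq, hprod.natDegree_mul' hq0, hd] at hRdeg
    rw [degree_eq_natDegree hq0]
    exact_mod_cast (by omega : q.natDegree < n)
  rw [hq, hnodal, neg_mul, map_neg, mul_assoc, ← jacobiFunctional_succ hα hβ ha hb,
    jacobiFunctional_jacobiMonic_mul ha hb hqdeg, neg_zero]

end Nodes

/-! ### Weights of the interior nodes -/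

section Bounds

variable {α β : ℝ} {κ n k : ℕ} {l : ℝ}

theorem eval_derivative_X_sub_C_mul (g : ℝ[X]) (r : ℝ) :
    (derivative ((X - C r) * g)).eval r = g.eval r := by
  simp [derivative_mul]

theorem X_sub_C_dvd_of_mul {g : ℝ[X]} {r s : ℝ} (hrs : s ≠ r) (h : ((X - C r) * g).eval s = 0) :
    X - C s ∣ g := by
  refine dvd_iff_isRoot.2 ?_
  rw [eval_mul, eval_sub, eval_X, eval_C] at h
  exact (mul_eq_zero.1 h).resolve_left (sub_ne_zero.2 hrs)

theorem natDegree_of_X_sub_C_mul {g : ℝ[X]} {r : ℝ} {d : ℕ} (hg : (X - C r) * g ≠ 0)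
    (hd : ((X - C r) * g).natDegree = d + 1) : g.natDegree = d := by
  rw [natDegree_mul (X_sub_C_ne_zero r) (right_ne_zero_of_mul hg), natDegree_X_sub_C] at hd
  omega

theorem natDegree_one_sub_X_sq : (1 - X ^ 2 : ℝ[X]).natDegree ≤ 2 := by
  compute_degree

/-- Lower bound for the weight of an interior node `r`: with `m = y / (X - r)`, exactness of the
rule for `(1 - X²) m²` gives `w_k (1 - r²) y'(r)² = ∫ m² w^{α+1,β+1}`, and the integral is at least
its part over an interval on which `|m| ≥ |y'(r)| / 2`. -/
theorem sub_mul_jacobiWeight_le (hα : -1 < α) (hβ : -1 < β)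
    (h : JacobiSolution κ (α + 1) (β + 1) l (jacobiMonic (α + 1) (β + 1) n)) (hk : 1 ≤ k)
    (hkn : k ≤ n) {p q A : ℝ} (hp : -1 ≤ p) (hpq : p ≤ q) (hq : q ≤ 1) (hA : 0 < A)
    (hr : lobattoNode α β n k ∉ Set.Ioo p q)
    (hy : ∀ t ∈ Set.Ioo p q,
      (derivative (jacobiMonic (α + 1) (β + 1) n)).eval (lobattoNode α β n k) ^ 2 *
        (t - lobattoNode α β n k) ^ 2 ≤ 4 * (jacobiMonic (α + 1) (β + 1) n).eval t ^ 2)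
    (hw : ∀ t ∈ Set.Ioo p q, jacobiWeight (α + 1) (β + 1) (lobattoNode α β n k) ≤
      A * jacobiWeight (α + 1) (β + 1) t) :
    (q - p) * jacobiWeight α β (lobattoNode α β n k) ≤ 4 * A * lobattoWeight α β n k := by
  have ha : -1 < α + 1 := by linarith
  have hb : -1 < β + 1 := by linarith
  have hr0 := eval_lobattoNode hα hβ hk hkn
  have hrI := h.mem_Ioo_of_root hr0
  have hmonic := monic_jacobiMonic ha hb n
  have hdeg := natDegree_jacobiMonic ha hb n
  have hv := h.derivative_ne_zero hr0
  have hnode : ∀ j, 1 ≤ j → j ≤ n →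
      (jacobiMonic (α + 1) (β + 1) n).eval (lobattoNode α β n j) = 0 :=
    fun j => eval_lobattoNode hα hβ
  set y := jacobiMonic (α + 1) (β + 1) n
  set r := lobattoNode α β n k with hrdef
  have hr2 : 0 < 1 - r ^ 2 := by nlinarith [hrI.1, hrI.2]
  obtain ⟨m, hm⟩ := dvd_iff_isRoot.2 hr0
  have hmr : m.eval r = (derivative y).eval r := by
    rw [hm, eval_derivative_X_sub_C_mul]
  have hmdeg : m.natDegree = n - 1 := by
    apply natDegree_of_X_sub_C_mul (r := r) (hm ▸ hmonic.ne_zero)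
    rw [← hm, hdeg]; omega
  have hym : ∀ t, y.eval t = (t - r) * m.eval t := fun t => by rw [hm]; simp
  have hex := jacobiFunctional_eq_mul_lobattoWeight hα hβ (n := n) (k := k) (by omega) (by omega)
    (F := (1 - X ^ 2) * (m * m))
    (by
      refine natDegree_mul_le.trans ?_
      have h1 := natDegree_one_sub_X_sq
      have h2 : (m * m).natDegree ≤ _ := natDegree_mul_le
      omega)
    (by
      intro j hj hjk
      rcases Nat.eq_zero_or_pos j with rfl | hj0
      · rw [lobattoNode_zero]; simp
      rcases eq_or_lt_of_le hj with rfl | hjn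
      · rw [lobattoNode_last]; simp
      have hne : lobattoNode α β n j ≠ r := fun he => hjk
        (lobattoNode_injOn hα hβ n (by simp; omega) (by simp; omega) he)
      have h1 := hnode j hj0 (by omega)
      rw [hym] at h1
      have h2 := (mul_eq_zero.1 h1).resolve_left (sub_ne_zero.2 hne)
      rw [eval_mul, eval_mul, h2]
      ring)
  rw [← jacobiFunctional_succ hα hβ ha hb, ← hrdef, eval_mul, eval_mul, hmr] at hex
  simp only [eval_sub, eval_one, eval_pow, eval_X] at hex
  have hge := le_jacobiFunctional ha hb (P := m * m) hp hpq hq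
    (M := (derivative y).eval r ^ 2 / 4 * (jacobiWeight (α + 1) (β + 1) r / A))
    (fun t => by rw [eval_mul]; exact mul_self_nonneg _)
    (fun t ht => by
      have htr : t ≠ r := fun he => hr (he ▸ ht)
      have h1 : (derivative y).eval r ^ 2 / 4 ≤ (m * m).eval t := by
        have h2 := hy t ht
        rw [hym, mul_pow, eval_mul] at *
        have h3 : 0 < (t - r) ^ 2 := sq_pos_of_ne_zero (sub_ne_zero.2 htr)
        nlinarith
      have h2 : jacobiWeight (α + 1) (β + 1) r / A ≤ jacobiWeight (α + 1) (β + 1) t := by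
        rw [div_le_iff₀ hA, mul_comm]
        exact hw t ht
      have h3 := (jacobiWeight_pos (α + 1) (β + 1) hrI).le
      exact mul_le_mul h1 h2 (by positivity) (le_trans (by positivity) h1))
  rw [hex, jacobiWeight_succ α β hrI] at hge
  have hv2 : 0 < (1 - r ^ 2) * (derivative y).eval r ^ 2 := by positivity
  refine le_of_mul_le_mul_left ?_ hv2
  have e : (derivative y).eval r ^ 2 / 4 * ((1 - r ^ 2) * jacobiWeight α β r / A) * (q - p) =
      (1 - r ^ 2) * (derivative y).eval r ^ 2 * ((q - p) * jacobiWeight α β r) / (4 * A) := by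
    field_simp
  rw [e, div_le_iff₀ (by positivity)] at hge
  linarith

/-- The polynomial `P = -(1 - X²) y² / ((X - r)² (X - p) (X - q))` for a root `r` of `y` and two
further zeros `p < r < q` of `(1 - X²) y`. -/
theorem exists_localized_polynomial {y : ℝ[X]} (hy0 : y ≠ 0) (hdeg : y.natDegree = n) {p r q : ℝ}
    (hpr : p < r) (hrq : r < q) (hr0 : y.eval r = 0) (hp : p = -1 ∨ y.eval p = 0)
    (hq : q = 1 ∨ y.eval q = 0) : ∃ P : ℝ[X], P.natDegree ≤ 2 * (n - 1) ∧
      (∀ t, P.eval t * ((t - r) ^ 2 * ((t - p) * (q - t))) = (1 - t ^ 2) * y.eval t ^ 2) ∧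
      P.eval r * ((r - p) * (q - r)) = (1 - r ^ 2) * (derivative y).eval r ^ 2 ∧
      ∀ s, y.eval s = 0 → s ≠ r → P.eval s = 0 := by
  have hn : 1 ≤ n := by
    rw [Nat.one_le_iff_ne_zero]
    rintro rfl
    obtain ⟨c, rfl⟩ := natDegree_eq_zero.1 hdeg
    rw [eval_C] at hr0
    exact hy0 (by rw [hr0, C_0])
  obtain ⟨m, hm⟩ := dvd_iff_isRoot.2 hr0
  have hmr : m.eval r = (derivative y).eval r := by
    rw [hm, eval_derivative_X_sub_C_mul]
  have hmdeg : m.natDegree = n - 1 := by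
    apply natDegree_of_X_sub_C_mul (r := r) (hm ▸ hy0)
    rw [← hm, hdeg]; omega
  have hym : ∀ t, y.eval t = (t - r) * m.eval t := fun t => by rw [hm]; simp
  -- divide `(1 - X²) y` by the three linear factors
  have hY0 : (1 - X ^ 2) * y ≠ 0 := by
    refine mul_ne_zero (fun h0 => ?_) hy0
    have := congrArg (eval 0) h0
    simp at this
  have hYdeg : ((1 - X ^ 2) * y).natDegree = n + 2 := by
    have h1 : (1 - X ^ 2 : ℝ[X]) = -((X - C 1) * (X - C (-1))) := by
      simp only [map_neg, C_1]; ring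
    rw [natDegree_mul (left_ne_zero_of_mul hY0) hy0, hdeg, h1, natDegree_neg,
      natDegree_mul (X_sub_C_ne_zero _) (X_sub_C_ne_zero _), natDegree_X_sub_C,
      natDegree_X_sub_C]
    omega
  have hroot : ∀ s, s = 1 ∨ s = -1 ∨ y.eval s = 0 → ((1 - X ^ 2) * y).eval s = 0 := by
    rintro s (rfl | rfl | hs)
    · simp
    · simp
    · rw [eval_mul, hs, mul_zero]
  obtain ⟨Y1, hY1⟩ := dvd_iff_isRoot.2 (hroot r (Or.inr (Or.inr hr0)))
  have hp0 := hroot p (Or.inr hp)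
  have hq0 := hroot q (hq.imp_right Or.inr)
  rw [hY1] at hp0 hq0
  obtain ⟨Y2, hY2⟩ := X_sub_C_dvd_of_mul hpr.ne hp0
  have hq1 := dvd_iff_isRoot.1 (X_sub_C_dvd_of_mul hrq.ne' hq0)
  rw [hY2] at hq1
  obtain ⟨N, hN⟩ := X_sub_C_dvd_of_mul (hpr.trans hrq).ne' hq1
  have hNdeg : N.natDegree = n - 1 := by
    have h1 : Y1.natDegree = n + 1 := by
      apply natDegree_of_X_sub_C_mul (r := r) (hY1 ▸ hY0)
      rw [← hY1, hYdeg]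
    have h1' : Y1 ≠ 0 := right_ne_zero_of_mul (hY1 ▸ hY0)
    have h2 : Y2.natDegree = n := by
      apply natDegree_of_X_sub_C_mul (r := p) (hY2 ▸ h1')
      rw [← hY2, h1]
    have h2' : Y2 ≠ 0 := right_ne_zero_of_mul (hY2 ▸ h1')
    apply natDegree_of_X_sub_C_mul (r := q) (hN ▸ h2')
    rw [← hN, h2]; omega
  have hYN : ∀ t, (1 - t ^ 2) * y.eval t = (t - r) * ((t - p) * ((t - q) * N.eval t)) := by
    intro t
    have := congrArg (eval t) hY1
    rw [hY2, hN] at this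
    simpa using this
  have hNr : (1 - r ^ 2) * (derivative y).eval r = (r - p) * ((r - q) * N.eval r) := by
    have h1 : (derivative ((1 - X ^ 2) * y)).eval r = (1 - r ^ 2) * (derivative y).eval r := by
      simp [derivative_mul, hr0]
    rw [← h1, hY1, eval_derivative_X_sub_C_mul, hY2, hN]
    simp
  refine ⟨-(m * N), ?_, fun t => ?_, ?_, fun s hs hsr => ?_⟩
  · rw [natDegree_neg]
    refine natDegree_mul_le.trans ?_
    omega
  · have h1 : (1 - t ^ 2) * y.eval t ^ 2 = ((1 - t ^ 2) * y.eval t) * y.eval t := by ring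
    rw [h1, hYN, hym, eval_neg, eval_mul]
    ring
  · have h1 : (1 - r ^ 2) * (derivative y).eval r ^ 2 =
      ((1 - r ^ 2) * (derivative y).eval r) * (derivative y).eval r := by ring
    rw [h1, hNr, eval_neg, eval_mul, hmr]
    ring
  · rw [hym] at hs
    rw [eval_neg, eval_mul, (mul_eq_zero.1 hs).resolve_left (sub_ne_zero.2 hsr)]
    ring

/-- Upper bound for the weight of an interior node `r`: exactness of the rule is applied to
`(1 - X²) P`, where `P = -(1 - X²) y² / ((X - r)² (X - p) (X - q))` and `p`, `q` are the
adjacent nodes. This `P` is nonpositive outside `[p, q]` and at most a multiple of `P(r)` inside. -/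
theorem lobattoWeight_le_of_sq_eval_le (hα : -1 < α) (hβ : -1 < β)
    (h : JacobiSolution κ (α + 1) (β + 1) l (jacobiMonic (α + 1) (β + 1) n)) (hk : 1 ≤ k)
    (hkn : k ≤ n) {p r q D W : ℝ} (hpk : p = lobattoNode α β n (k - 1))
    (hrk : r = lobattoNode α β n k) (hqk : q = lobattoNode α β n (k + 1)) (hD : 0 ≤ D)
    (hl : ∀ t ∈ Set.Icc p r,
      (1 - t ^ 2) * (jacobiMonic (α + 1) (β + 1) n).eval t ^ 2 * (r - p) ≤
        D * ((1 - r ^ 2) * (derivative (jacobiMonic (α + 1) (β + 1) n)).eval r ^ 2 *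
          (r - t) ^ 2 * (t - p)))
    (hr : ∀ t ∈ Set.Icc r q,
      (1 - t ^ 2) * (jacobiMonic (α + 1) (β + 1) n).eval t ^ 2 * (q - r) ≤
        D * ((1 - r ^ 2) * (derivative (jacobiMonic (α + 1) (β + 1) n)).eval r ^ 2 *
          (t - r) ^ 2 * (q - t)))
    (hw : ∀ t ∈ Set.Icc p q, jacobiWeight (α + 1) (β + 1) t ≤
      W * jacobiWeight (α + 1) (β + 1) r) :
    lobattoWeight α β n k ≤ D * W * ((q - p) * jacobiWeight α β r) := by
  have ha : -1 < α + 1 := by linarith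
  have hb : -1 < β + 1 := by linarith
  have hgl := isGap_lobattoNode hα hβ (n := n) (k := k - 1) (by omega)
  have hgr := isGap_lobattoNode hα hβ (n := n) (k := k) hkn
  rw [Nat.sub_add_cancel hk] at hgl
  have hr0 := eval_lobattoNode hα hβ hk hkn
  rw [← hpk, ← hrk] at hgl
  rw [← hrk, ← hqk] at hgr
  rw [← hrk] at hr0
  have hrI := h.mem_Ioo_of_root hr0
  have hpr := hgl.lt
  have hrq := hgr.lt
  have hp1 := hgl.neg_one_le
  have hq1 := hgr.le_one
  have hmonic := monic_jacobiMonic ha hb n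
  have hdeg := natDegree_jacobiMonic ha hb n
  have hv := h.derivative_ne_zero hr0
  have hnode : ∀ j, 1 ≤ j → j ≤ n →
      (jacobiMonic (α + 1) (β + 1) n).eval (lobattoNode α β n j) = 0 :=
    fun j => eval_lobattoNode hα hβ
  set y := jacobiMonic (α + 1) (β + 1) n
  have hr2 : 0 < 1 - r ^ 2 := by nlinarith [hrI.1, hrI.2]
  obtain ⟨P, hPdeg, hPt, hPr, hPs⟩ := exists_localized_polynomial hmonic.ne_zero hdeg hpr hrq hr0
    hgl.left hgr.right
  have hrp0 : 0 < r - p := sub_pos.2 hpr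
  have hqr0 : 0 < q - r := sub_pos.2 hrq
  have hPr0 : 0 < P.eval r := by
    have h1 : 0 < P.eval r * ((r - p) * (q - r)) := by rw [hPr]; positivity
    exact pos_of_mul_pos_left h1 (by positivity)
  have hex := jacobiFunctional_eq_mul_lobattoWeight hα hβ (n := n) (k := k) (by omega) (by omega)
    (F := (1 - X ^ 2) * P)
    (by
      refine natDegree_mul_le.trans ?_
      have h1 := natDegree_one_sub_X_sq
      omega)
    (by
      intro j hj hjk
      rcases Nat.eq_zero_or_pos j with rfl | hj0
      · rw [lobattoNode_zero]; simp
      rcases eq_or_lt_of_le hj with rfl | hjn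
      · rw [lobattoNode_last]; simp
      have hne : lobattoNode α β n j ≠ r := fun he => hjk
        (lobattoNode_injOn hα hβ n (by simp; omega) (by simp; omega) (he.trans hrk))
      rw [eval_mul, hPs _ (hnode j hj0 (by omega)) hne, mul_zero])
  rw [← jacobiFunctional_succ hα hβ ha hb, ← hrk, eval_mul] at hex
  simp only [eval_sub, eval_one, eval_pow, eval_X] at hex
  have hle := jacobiFunctional_le ha hb (P := P) (M := D * P.eval r) hp1 hpr.le hrq.le hq1
    (by
      intro t ht
      have h1 := hl t ⟨ht.1.le, ht.2.le⟩
      rw [← hPt, ← hPr] at h1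
      have t1 : 0 < t - p := sub_pos.2 ht.1
      have t2 : 0 < (t - r) ^ 2 := sq_pos_of_ne_zero (sub_ne_zero.2 ht.2.ne)
      have t3 : q - r ≤ q - t := by linarith [ht.2]
      by_contra! hlt
      have h2 : D * P.eval r * (q - r) < P.eval t * (q - t) :=
        mul_lt_mul hlt t3 hqr0 ((mul_nonneg hD hPr0.le).trans hlt.le)
      have h3 : 0 < (t - r) ^ 2 * (t - p) * (r - p) := by positivity
      nlinarith [mul_lt_mul_of_pos_left h2 h3])
    (by
      intro t ht
      have h1 := hr t ⟨ht.1.le, ht.2.le⟩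
      rw [← hPt, ← hPr] at h1
      have t1 : 0 < q - t := sub_pos.2 ht.2
      have t2 : 0 < (t - r) ^ 2 := sq_pos_of_ne_zero (sub_ne_zero.2 ht.1.ne')
      have t3 : r - p ≤ t - p := by linarith [ht.1]
      by_contra! hlt
      have h2 : D * P.eval r * (r - p) < P.eval t * (t - p) :=
        mul_lt_mul hlt t3 hrp0 ((mul_nonneg hD hPr0.le).trans hlt.le)
      have h3 : 0 < (t - r) ^ 2 * (q - t) * (q - r) := by positivity
      nlinarith [mul_lt_mul_of_pos_left h2 h3])
    (by
      intro t ht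
      have t0 : 0 ≤ 1 - t ^ 2 := by
        rcases ht with ht | ht <;> nlinarith [ht.1, ht.2]
      have t1 : (t - r) ^ 2 * ((t - p) * (q - t)) < 0 := by
        rcases ht with ht | ht
        · have : t - r < 0 := by linarith [ht.2]
          exact mul_neg_of_pos_of_neg (sq_pos_of_neg this)
            (mul_neg_of_neg_of_pos (by linarith [ht.2]) (by linarith [ht.2]))
        · have : 0 < t - r := by linarith [ht.1]
          exact mul_neg_of_pos_of_neg (by positivity)
            (mul_neg_of_pos_of_neg (by linarith [ht.1]) (by linarith [ht.1]))
      by_contra! hlt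
      have := mul_neg_of_pos_of_neg hlt t1
      rw [hPt] at this
      have : 0 ≤ (1 - t ^ 2) * y.eval t ^ 2 := by positivity
      linarith)
  have hint : ∫ t in p..q, jacobiWeight (α + 1) (β + 1) t ≤
      (q - p) * (W * jacobiWeight (α + 1) (β + 1) r) := by
    have := intervalIntegral.integral_mono_on (hpr.trans hrq).le
      (intervalIntegrable_jacobiWeight_of_le ha hb hp1 (hpr.trans hrq).le hq1)
      (intervalIntegrable_const (c := W * jacobiWeight (α + 1) (β + 1) r)) hw
    rwa [intervalIntegral.integral_const, smul_eq_mul] at this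
  rw [jacobiWeight_succ α β hrI] at hint
  rw [hex] at hle
  have h1 := hle.trans (mul_le_mul_of_nonneg_left hint (mul_nonneg hD hPr0.le))
  have h2 : 0 < (1 - r ^ 2) * P.eval r := by positivity
  refine le_of_mul_le_mul_left ?_ h2
  linarith

end Bounds

/-! ### Weights of the end points and the two-sided bounds -/

section Main

variable {α β : ℝ} {κ n k : ℕ} {l : ℝ}

/-- Upper bound for the weight of an end point `e = ±1`, by exactness of the rule for
`(X + e) y² / (X - z)`, where `z` is the root next to `e`. -/
theorem lobattoWeight_end_le (hα : -1 < α) (hβ : -1 < β) (hn : 1 ≤ n) {e z p q D : ℝ}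
    (he : e = -1 ∨ e = 1) (hk : k ≤ n + 1) (hek : lobattoNode α β n k = e)
    (hz : (jacobiMonic (α + 1) (β + 1) n).eval z = 0) (hp : -1 ≤ p) (hpq : p ≤ q) (hq : q ≤ 1)
    (hin : ∀ t ∈ Set.Ioo p q, 0 < e * (t - z))
    (hout : ∀ t, (-1 < t ∧ t < p) ∨ (q < t ∧ t < 1) → e * (t - z) < 0)
    (hez : 0 < e * (e - z)) (hye : (jacobiMonic (α + 1) (β + 1) n).eval e ≠ 0)
    (hy : ∀ t ∈ Set.Ioo p q, (1 + e * t) * (jacobiMonic (α + 1) (β + 1) n).eval t ^ 2 *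
      (e * (e - z)) ≤ D * (2 * (jacobiMonic (α + 1) (β + 1) n).eval e ^ 2 * (e * (t - z)))) :
    lobattoWeight α β n k ≤ D * ∫ t in p..q, jacobiWeight α β t := by
  have ha : -1 < α + 1 := by linarith
  have hb : -1 < β + 1 := by linarith
  have hdeg := natDegree_jacobiMonic ha hb n
  have hmonic := monic_jacobiMonic ha hb n
  have hnode : ∀ j, 1 ≤ j → j ≤ n →
      (jacobiMonic (α + 1) (β + 1) n).eval (lobattoNode α β n j) = 0 :=
    fun j => eval_lobattoNode hα hβ
  set y := jacobiMonic (α + 1) (β + 1) n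
  have he2 : e * e = 1 := by rcases he with rfl | rfl <;> norm_num
  obtain ⟨m, hm⟩ := dvd_iff_isRoot.2 hz
  have hmdeg : m.natDegree = n - 1 := by
    apply natDegree_of_X_sub_C_mul (r := z) (hm ▸ hmonic.ne_zero)
    rw [← hm, hdeg]; omega
  have hym : ∀ t, y.eval t = (t - z) * m.eval t := fun t => by rw [hm]; simp
  set F := (X + C e) * (y * m) with hF
  have hFt : ∀ t, F.eval t * (e * (t - z)) = (1 + e * t) * y.eval t ^ 2 := by
    intro t
    have h1 : y.eval t ^ 2 = y.eval t * ((t - z) * m.eval t) := by rw [← hym]; ring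
    rw [h1, hF, eval_mul, eval_mul, eval_add, eval_X, eval_C]
    linear_combination (y.eval t * m.eval t * (t - z)) * he2
  have hFe : F.eval e * (e * (e - z)) = 2 * y.eval e ^ 2 := by
    rw [hFt, he2]; norm_num
  have hFe0 : 0 < F.eval e := by
    have : 0 < F.eval e * (e * (e - z)) := by rw [hFe]; positivity
    exact pos_of_mul_pos_left this hez.le
  have hex := jacobiFunctional_eq_mul_lobattoWeight hα hβ hn hk (F := F)
    (by
      have h1 : F.natDegree ≤ _ := natDegree_mul_le
      have h2 : (y * m).natDegree ≤ _ := natDegree_mul_le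
      rw [natDegree_X_add_C] at h1
      omega)
    (by
      intro j hj hjk
      by_cases hjI : 1 ≤ j ∧ j ≤ n
      · rw [hF, eval_mul, eval_mul, hnode j hjI.1 hjI.2]
        ring
      · have hj' : lobattoNode α β n j = -1 ∨ lobattoNode α β n j = 1 := by
          rcases Nat.eq_zero_or_pos j with rfl | hj0
          · exact Or.inl (lobattoNode_zero α β n)
          · obtain rfl : j = n + 1 := by omega
            exact Or.inr (lobattoNode_last α β n)
        have hne : lobattoNode α β n j ≠ e := fun h1 => hjk
          (lobattoNode_injOn hα hβ n (by simp; omega) (by simp; omega) (h1.trans hek.symm))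
        have : lobattoNode α β n j + e = 0 := by
          rcases he with rfl | rfl <;> rcases hj' with h1 | h1 <;> rw [h1] at hne ⊢ <;>
            first | exact absurd rfl hne | norm_num
        rw [hF, eval_mul, eval_add, eval_X, eval_C, this, zero_mul])
  rw [hek] at hex
  have hle := jacobiFunctional_le hα hβ (P := F) (M := D * F.eval e) hp le_rfl hpq hq
    (fun t ht => absurd (ht.1.trans ht.2) (lt_irrefl _))
    (fun t ht => by
      have h1 := hy t ht
      rw [← hFt, ← hFe] at h1
      have h2 : 0 < e * (t - z) * (e * (e - z)) := mul_pos (hin t ht) hez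
      refine le_of_mul_le_mul_right ?_ h2
      linarith)
    (fun t ht => by
      have t0 : 0 ≤ 1 + e * t := by
        rcases he with rfl | rfl <;> rcases ht with ht | ht <;> linarith [ht.1, ht.2]
      by_contra! hlt
      have h1 := mul_neg_of_pos_of_neg hlt (hout t ht)
      rw [hFt] at h1
      have : 0 ≤ (1 + e * t) * y.eval t ^ 2 := by positivity
      linarith)
  rw [hex] at hle
  refine le_of_mul_le_mul_left ?_ hFe0
  linarith

theorem JacobiSolution.eval_ne_zero {a b : ℝ} {y : ℝ[X]} (h : JacobiSolution κ a b l y) {e : ℝ}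
    (he : e = -1 ∨ e = 1) : y.eval e ≠ 0 := by
  intro h0
  have := h.mem_Ioo_of_root h0
  rcases he with rfl | rfl
  · exact lt_irrefl _ this.1
  · exact lt_irrefl _ this.2

theorem exists_lobattoWeight_zero_le (κ : ℕ) : ∃ D : ℝ, 0 ≤ D ∧ ∀ {α β l : ℝ} {n : ℕ},
    -1 < α → -1 < β → 1 ≤ n →
    JacobiSolution κ (α + 1) (β + 1) l (jacobiMonic (α + 1) (β + 1) n) →
    lobattoWeight α β n 0 ≤
      D / (β + 1) * (lobattoGap α β n 0 * jacobiWeight α β (lobattoNode α β n 1)) := by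
  obtain ⟨E, hE, hend⟩ := JacobiSolution.exists_sq_eval_le_neg_one κ
  refine ⟨E * (2 * (κ : ℝ) ^ 2 + 42) ^ κ, by positivity, fun {α β l n} hα hβ hn h => ?_⟩
  have hg := isGap_lobattoNode hα hβ (n := n) (k := 0) (by omega)
  have hz := eval_lobattoNode hα hβ (n := n) (k := 1) le_rfl hn
  rw [lobattoNode_zero, zero_add] at hg
  rw [lobattoGap, lobattoNode_zero, zero_add]
  set z := lobattoNode α β n 1
  have h1 := lobattoWeight_end_le hα hβ hn (e := -1) (D := E) (Or.inl rfl) (Nat.zero_le _)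
    (lobattoNode_zero α β n) hz le_rfl hg.lt.le hg.le_one
    (fun t ht => by linarith [ht.2])
    (fun t ht => by rcases ht with ht | ht <;> linarith [ht.1, ht.2])
    (by linarith [hg.lt]) (JacobiSolution.eval_ne_zero h (Or.inl rfl))
    (fun t ht => by
      have := hend h hg hz t ⟨ht.1.le, ht.2.le⟩
      have e1 : -1 * (-1 - z) = 1 + z := by ring
      have e2 : -1 * (t - z) = z - t := by ring
      have e3 : 1 + -1 * t = 1 - t := by ring
      rw [e1, e2, e3]
      exact this)
  have h2 := h.integral_jacobiWeight_le hg hz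
  refine h1.trans ((mul_le_mul_of_nonneg_left h2 (by linarith)).trans (le_of_eq ?_))
  ring

theorem exists_lobattoWeight_last_le (κ : ℕ) : ∃ D : ℝ, 0 ≤ D ∧ ∀ {α β l : ℝ} {n : ℕ},
    -1 < α → -1 < β → 1 ≤ n →
    JacobiSolution κ (α + 1) (β + 1) l (jacobiMonic (α + 1) (β + 1) n) →
    lobattoWeight α β n (n + 1) ≤
      D / (α + 1) * (lobattoGap α β n n * jacobiWeight α β (lobattoNode α β n n)) := by
  obtain ⟨E, hE, hend⟩ := JacobiSolution.exists_sq_eval_le_neg_one κ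
  refine ⟨E * (2 * (κ : ℝ) ^ 2 + 42) ^ κ, by positivity, fun {α β l n} hα hβ hn h => ?_⟩
  have hg := isGap_lobattoNode hα hβ (n := n) (k := n) le_rfl
  have hz := eval_lobattoNode hα hβ (n := n) (k := n) hn le_rfl
  rw [lobattoNode_last] at hg
  rw [lobattoGap, lobattoNode_last]
  set z := lobattoNode α β n n
  have hg' := hg.reflect
  have hz' : ((jacobiMonic (α + 1) (β + 1) n).comp (-X)).eval (-z) = 0 := by simpa using hz
  have h1 := lobattoWeight_end_le hα hβ hn (e := 1) (D := E) (Or.inr rfl) le_rfl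
    (lobattoNode_last α β n) hz hg.neg_one_le hg.lt.le le_rfl
    (fun t ht => by linarith [ht.1])
    (fun t ht => by rcases ht with ht | ht <;> linarith [ht.1, ht.2])
    (by linarith [hg.lt]) (JacobiSolution.eval_ne_zero h (Or.inr rfl))
    (fun t ht => by
      have := hend h.reflect hg' hz' (-t) ⟨by linarith [ht.2], by linarith [ht.1]⟩
      simp only [eval_comp, eval_neg, eval_X, neg_neg] at this
      have e1 : 1 * (1 - z) = 1 + -z := by ring
      have e2 : 1 * (t - z) = -z - -t := by ring
      have e3 : 1 + 1 * t = 1 - -t := by ring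
      rw [e1, e2, e3]
      exact this)
  have h2 := h.reflect.integral_jacobiWeight_le hg' hz'
  have h3 : ∫ t in z..1, jacobiWeight α β t = ∫ t in (-1 : ℝ)..(-z), jacobiWeight β α t := by
    rw [← intervalIntegral.integral_comp_neg]
    simp only [jacobiWeight_neg]
  rw [jacobiWeight_neg, ← h3] at h2
  refine h1.trans ((mul_le_mul_of_nonneg_left h2 (by linarith)).trans (le_of_eq ?_))
  ring

/-- Two-sided bounds for the weights of the interior nodes, in terms of either adjacent gap. -/
theorem exists_lobattoWeight_comparable (κ : ℕ) : ∃ D : ℝ, 0 ≤ D ∧ ∀ {α β l : ℝ} {n k : ℕ},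
    -1 < α → -1 < β → 1 ≤ k → k ≤ n →
    JacobiSolution κ (α + 1) (β + 1) l (jacobiMonic (α + 1) (β + 1) n) →
    ∀ j, j = k ∨ j + 1 = k →
      lobattoGap α β n j * jacobiWeight α β (lobattoNode α β n k) ≤ D * lobattoWeight α β n k ∧
      lobattoWeight α β n k ≤
        D * (lobattoGap α β n j * jacobiWeight α β (lobattoNode α β n k)) := by
  obtain ⟨c, hc, hc2, hlow⟩ := JacobiSolution.exists_sq_eval_ge κ
  obtain ⟨U, hU, hup⟩ := JacobiSolution.exists_sq_eval_le κ
  obtain ⟨G, hG, hgap⟩ := JacobiSolution.exists_adjacent_gaps_comparable κ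
  set W := (2 * (κ : ℝ) ^ 2 + 42) ^ κ with hW
  have hW0 : 0 < W := by positivity
  refine ⟨G * (4 * 2 ^ κ) / c + U * W * (1 + G), by positivity,
    fun {α β l n k} hα hβ hk hkn h j hj => ?_⟩
  have hgl := isGap_lobattoNode hα hβ (n := n) (k := k - 1) (by omega)
  have hgr := isGap_lobattoNode hα hβ (n := n) (k := k) hkn
  rw [Nat.sub_add_cancel hk] at hgl
  have hr0 := eval_lobattoNode hα hβ hk hkn
  have hrI := h.mem_Ioo_of_root hr0
  obtain ⟨p, hp⟩ : ∃ p, p = lobattoNode α β n (k - 1) := ⟨_, rfl⟩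
  obtain ⟨r, hr⟩ : ∃ r, r = lobattoNode α β n k := ⟨_, rfl⟩
  obtain ⟨q, hq⟩ : ∃ q, q = lobattoNode α β n (k + 1) := ⟨_, rfl⟩
  rw [← hp, ← hr] at hgl
  rw [← hr, ← hq] at hgr
  rw [← hr] at hr0 hrI
  have hpr := hgl.lt
  have hrq := hgr.lt
  have hr0' : ((jacobiMonic (α + 1) (β + 1) n).comp (-X)).eval (-r) = 0 := by simpa using hr0
  obtain ⟨hG1, hG2⟩ := hgap h hgl hgr hr0
  have hw0 : 0 < jacobiWeight α β r := jacobiWeight_pos α β hrI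
  have hupper : lobattoWeight α β n k ≤ U * W * ((q - p) * jacobiWeight α β r) := by
    refine lobattoWeight_le_of_sq_eval_le hα hβ h hk hkn hp hr hq (by linarith)
      (fun t ht => hup h hgl hr0 t ht) (fun t ht => ?_) (fun t ht => ?_)
    · have := hup h.reflect hgr.reflect hr0' (-t) ⟨by linarith [ht.2], by linarith [ht.1]⟩
      simp only [derivative_comp, eval_comp, eval_mul, derivative_neg, derivative_X, eval_neg,
        eval_one, eval_X, neg_neg, neg_sq] at this
      have e1 : -r - -q = q - r := by ring
      have e2 : -t - -q = q - t := by ring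
      have e3 : -r - -t = t - r := by ring
      have e4 : ∀ v : ℝ, (-1 * v) ^ 2 = v ^ 2 := fun v => by ring
      rw [e1, e2, e3, e4] at this
      exact this
    · rcases le_total t r with htr | htr
      · exact h.jacobiWeight_le hgl hr0 ⟨ht.1, htr⟩
      · have := h.reflect.jacobiWeight_le hgr.reflect hr0' (t := -t)
          ⟨by linarith [ht.2], by linarith⟩
        rwa [jacobiWeight_neg, jacobiWeight_neg] at this
  have hlower : c * (r - p) * jacobiWeight α β r ≤ 4 * 2 ^ κ * lobattoWeight α β n k := by
    have hcp : c * (r - p) ≤ (r - p) / 2 := by nlinarith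
    have hcp0 : 0 < c * (r - p) := mul_pos hc (by linarith)
    have := sub_mul_jacobiWeight_le hα hβ h hk hkn (p := r - c * (r - p)) (q := r) (A := 2 ^ κ)
      (by linarith [hgl.neg_one_le]) (by linarith) (by linarith [hgl.le_one]) (by positivity)
      (by rw [← hr]; exact fun h1 => lt_irrefl _ h1.2)
      (fun t ht => by rw [← hr]; exact hlow h hgl hr0 t ⟨ht.1.le, ht.2.le⟩)
      (fun t ht => by
        rw [← hr]
        exact h.le_jacobiWeight hgl hr0 (by linarith [ht.1]) ht.2.le)
    rw [← hr, sub_sub_cancel] at this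
    exact this
  obtain ⟨g, hg⟩ : ∃ g, g = lobattoGap α β n j := ⟨_, rfl⟩
  have hgcases : g = q - r ∨ g = r - p := by
    rcases hj with rfl | rfl
    · left; rw [hg, lobattoGap, hq, hr]
    · right; rw [hg, lobattoGap, hp, hr, Nat.add_sub_cancel]
  have hg0 : 0 ≤ g := by rcases hgcases with h1 | h1 <;> rw [h1] <;> linarith
  have hg1 : g ≤ G * (r - p) := by
    rcases hgcases with h1 | h1 <;> rw [h1]
    · exact hG2
    · nlinarith
  have hg2 : q - p ≤ (1 + G) * g := by
    rcases hgcases with h1 | h1 <;> rw [h1] <;> linarith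
  rw [← hg, ← hr]
  have hwk : 0 ≤ lobattoWeight α β n k := by
    have h1 : 0 ≤ c * (r - p) * jacobiWeight α β r :=
      mul_nonneg (mul_nonneg hc.le (by linarith)) hw0.le
    exact nonneg_of_mul_nonneg_right (h1.trans hlower) (by positivity)
  have hlow' : g * jacobiWeight α β r ≤ G * (4 * 2 ^ κ) / c * lobattoWeight α β n k := by
    calc g * jacobiWeight α β r ≤ G * (r - p) * jacobiWeight α β r := by gcongr
      _ = G / c * (c * (r - p) * jacobiWeight α β r) := by field_simp
      _ ≤ G / c * (4 * 2 ^ κ * lobattoWeight α β n k) := by gcongr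
      _ = _ := by ring
  have hup' : lobattoWeight α β n k ≤ U * W * (1 + G) * (g * jacobiWeight α β r) := by
    calc lobattoWeight α β n k ≤ U * W * ((q - p) * jacobiWeight α β r) := hupper
      _ ≤ U * W * ((1 + G) * g * jacobiWeight α β r) := by gcongr
      _ = _ := by ring
  have n1 : 0 ≤ U * W * (1 + G) * lobattoWeight α β n k := by positivity
  have n2 : 0 ≤ G * (4 * 2 ^ κ) / c * (g * jacobiWeight α β r) := by positivity
  constructor <;> linarith

end Main

theorem lemma1 (α β : ℝ) (hα : -1 < α) (hβ : -1 < β) :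
    ∃ C : ℝ, 0 < C ∧ ∀ n : ℕ, 1 ≤ n →
      lobattoWeight α β n 0 ≤
          C * (lobattoGap α β n 0 * jacobiWeight α β (lobattoNode α β n 1)) ∧
      (∀ k : ℕ, 1 ≤ k → k + 1 ≤ n →
        1 / C ≤ lobattoWeight α β n k /
            (lobattoGap α β n k * jacobiWeight α β (lobattoNode α β n k)) ∧
        lobattoWeight α β n k /
            (lobattoGap α β n k * jacobiWeight α β (lobattoNode α β n k)) ≤ C) ∧
      (1 / C ≤ lobattoWeight α β n n /
            (lobattoGap α β n (n - 1) * jacobiWeight α β (lobattoNode α β n n)) ∧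
        lobattoWeight α β n n /
            (lobattoGap α β n (n - 1) * jacobiWeight α β (lobattoNode α β n n)) ≤ C) ∧
      lobattoWeight α β n (n + 1) ≤
          C * (lobattoGap α β n n * jacobiWeight α β (lobattoNode α β n n)) := by
  have ha : 0 < α + 1 := by linarith
  have hb : 0 < β + 1 := by linarith
  obtain ⟨κ, hκ⟩ := exists_nat_ge (2 * (α + 1) + 2 * (β + 1) + 1)
  obtain ⟨D0, hD0, h0⟩ := exists_lobattoWeight_zero_le κ
  obtain ⟨D1, hD1, h1⟩ := exists_lobattoWeight_last_le κ
  obtain ⟨D, hD, h⟩ := exists_lobattoWeight_comparable κ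
  have e0 : 0 ≤ D0 / (β + 1) := by positivity
  have e1 : 0 ≤ D1 / (α + 1) := by positivity
  refine ⟨D0 / (β + 1) + D1 / (α + 1) + D + 1, by positivity, fun n hn => ?_⟩
  have hsol := jacobiSolution_jacobiMonic ha hb hκ hn
  have hpos : ∀ j k, 1 ≤ k → k ≤ n → j ≤ n →
      0 < lobattoGap α β n j * jacobiWeight α β (lobattoNode α β n k) := fun j k hk hkn hj =>
    mul_pos (sub_pos.2 (lobattoNode_lt_succ hα hβ hj))
      (jacobiWeight_pos α β (hsol.mem_Ioo_of_root (eval_lobattoNode hα hβ hk hkn)))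
  have hmid : ∀ j k, 1 ≤ k → k ≤ n → (j = k ∨ j + 1 = k) →
      1 / (D0 / (β + 1) + D1 / (α + 1) + D + 1) ≤ lobattoWeight α β n k /
        (lobattoGap α β n j * jacobiWeight α β (lobattoNode α β n k)) ∧
      lobattoWeight α β n k / (lobattoGap α β n j * jacobiWeight α β (lobattoNode α β n k)) ≤
        D0 / (β + 1) + D1 / (α + 1) + D + 1 := by
    intro j k hk hkn hj
    obtain ⟨hl, hu⟩ := h hα hβ hk hkn hsol j hj
    have hp := hpos j k hk hkn (by omega)
    have hwk : 0 ≤ lobattoWeight α β n k := by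
      by_contra! hneg
      nlinarith
    rw [div_le_div_iff₀ (by positivity) hp, div_le_iff₀ hp]
    constructor <;> nlinarith
  refine ⟨?_, fun k hk hkn => hmid k k hk (by omega) (Or.inl rfl),
    hmid (n - 1) n hn le_rfl (Or.inr (by omega)), ?_⟩
  · refine (h0 hα hβ hn hsol).trans (mul_le_mul_of_nonneg_right ?_ (hpos 0 1 le_rfl hn ?_).le)
    · linarith
    · omega
  · refine (h1 hα hβ hn hsol).trans (mul_le_mul_of_nonneg_right ?_ (hpos n n hn le_rfl le_rfl).le)
    linarith
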